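/- Let $f\in C^1([0,\infty),\mathbb R)$, let $q_0>0$ with $f'(q_0)>0$, and let $V\in C^2(\mathbb R,\mathbb R)$ satisfy $|V(x)|\le Ae^{-\kappa|x|}$ for all $x\in\mathbb R$ with some $A,\kappa>0$. For $\epsilon\in\mathbb R$ consider the Gross--Pitaevskii equation $$ i u_t=-\tfrac12 u_{xx}+f(|u|^2)u+\epsilon V(x)u ,\qquad x\in\mathbb R . $$ A *kink mode* for $\epsilon$ is a real-valued function $\phi\in C^2(\mathbb R)$ such that $u(x,t)=\phi(x)e^{-if(q_0)t+i\theta}$ is a classical solution for every $\theta\in\mathbb R$ and $\phi(x)\to\pm\sqrt{q_0}$ exponentially fast as $x\to\pm\infty$. Let $\phi_0$ be the NLS kink, that is, an odd kink mode for $\epsilon=0$. Suppose that $s_0$ is a simple root of $$ M'(s)=\int_{\mathbb R}V'(x)\left[q_0-\phi_0^2(x-s)\right]dx $$ (the integral being understood as $\lim_{R\to\infty}\int_{-R}^{R}$), i.e. $M'(s_0)=0$ and $M''(s_0)\ne0$. Then for all sufficiently small $\epsilon$ the shifted kink $\phi_0(x-s_0)$ has a unique continuation to a kink mode $\phi_\epsilon(x-s_\epsilon)$,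 with $\phi_\epsilon$ and $s_\epsilon$ being $\epsilon$-close to $\phi_0$ and $s_0$ in the $L^\infty$-norm. Precisely, there are $\epsilon_0,\delta,C>0$ and a family $(\phi_\epsilon,s_\epsilon)_{\epsilon\in\mathbb R}$ of functions $\phi_\epsilon:\mathbb R\to\mathbb R$ and numbers $s_\epsilon\in\mathbb R$ such that: 1. for every $|\epsilon|<\epsilon_0$, the function $x\mapsto\phi_\epsilon(x-s_\epsilon)$ is a kink mode for $\epsilon$; $\|\phi_\epsilon-\phi_0\|_{L^\infty}\le C|\epsilon|$ and $|s_\epsilon-s_0|\le C|\epsilon|$; the position $s_\epsilon$ is normalized by $\int_{\mathbb R}\phi_0'(x)\,[\phi_\epsilon(x)-\phi_0(x)]\,dx=0$; and $\epsilon\mapsto\phi_\epsilon$ (in the sup norm) and $\epsilon\mapsto s_\epsilon$ are continuous on $(-\epsilon_0,\epsilon_0)$; 2. for every $0<|\epsilon|<\epsilon_0$, if $\psi:\mathbb R\to\mathbb R$ and $\sigma\in\mathbb R$ satisfy $\|\psi-\phi_0\|_{L^\infty}\le\delta$ and $|\sigma-s_0|\le\delta$, and $x\mapsto\psi(x-\sigma)$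 is a kink mode for $\epsilon$, then $\psi(x-\sigma)=\phi_\epsilon(x-s_\epsilon)$ for all $x$; if moreover $\int_{\mathbb R}\phi_0'(x)[\psi(x)-\phi_0(x)]\,dx=0$, then $\psi=\phi_\epsilon$ and $\sigma=s_\epsilon$. -/

import Mathlib

open Filter Topology

/-- `u x t` is a classical solution of the Gross–Pitaevskii equation
`i u_t = -(1/2) u_xx + f(|u|²) u + ε V(x) u` on the line. -/
def IsGPSolution (f V : ℝ → ℝ) (ε : ℝ) (u : ℝ → ℝ → ℂ) : Prop :=
  (∀ t, ContDiff ℝ 2 (fun x => u x t)) ∧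
  (∀ x, Differentiable ℝ (fun t => u x t)) ∧
  ∀ x t, Complex.I * deriv (fun τ => u x τ) t =
    -(1 / 2) * iteratedDeriv 2 (fun y => u y t) x
      + (f (‖u x t‖ ^ 2) : ℂ) * u x t + ((ε * V x : ℝ) : ℂ) * u x t

/-- The standing wave `φ(x) e^{-iωt + iθ}`. -/
noncomputable def standingWave (φ : ℝ → ℝ) (ω θ : ℝ) (x t : ℝ) : ℂ :=
  (φ x : ℂ) * Complex.exp (-Complex.I * ω * t + Complex.I * θ)

/-- `φ(x) → ±√q₀` as `x → ±∞`, exponentially fast. -/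
def ConvergesExponentially (q₀ : ℝ) (φ : ℝ → ℝ) : Prop :=
  ∃ C > 0, ∃ κ > 0, ∀ x : ℝ, 0 ≤ x →
    |φ x - Real.sqrt q₀| ≤ C * Real.exp (-κ * x) ∧
    |φ (-x) + Real.sqrt q₀| ≤ C * Real.exp (-κ * x)

/-- The profile `φ` is a kink mode of the Gross–Pitaevskii equation with potential `ε V`:
`φ(x) e^{-i f(q₀) t + iθ}` is a classical solution for all phases `θ`, and `φ → ±√q₀`
exponentially fast at `±∞`. -/
structure IsKinkMode (f V : ℝ → ℝ) (q₀ ε : ℝ) (φ : ℝ → ℝ) : Prop where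
  contDiff : ContDiff ℝ 2 φ
  solution : ∀ θ : ℝ, IsGPSolution f V ε (standingWave φ (f q₀) θ)
  limits : ConvergesExponentially q₀ φ

/-- The profile `φ` is a kink of the NLS equation (zero potential): an odd black soliton
(in particular `φ 0 = 0`) connecting `-√q₀` to `√q₀`. -/
structure IsNLSKink (f : ℝ → ℝ) (q₀ : ℝ) (φ : ℝ → ℝ) : Prop where
  kinkMode : IsKinkMode f 0 q₀ 0 φ
  odd : ∀ x, φ (-x) = -φ x

/-- `M'` is the derivative of the effective potential:
`M'(s) = ∫_ℝ V'(x) [q₀ - φ₀(x - s)²] dx`, the integral over the line being the limit of the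
integrals over `[-R, R]` (it is the Lebesgue integral whenever the integrand is integrable;
decay of `V'` is not required). -/
def IsEffectiveForce (V : ℝ → ℝ) (q₀ : ℝ) (φ₀ M' : ℝ → ℝ) : Prop :=
  ∀ s : ℝ, Tendsto (fun R : ℝ => ∫ x in (-R)..R, deriv V x * (q₀ - φ₀ (x - s) ^ 2))
    atTop (𝓝 (M' s))

/-- The perturbation `ψ - φ₀` is `L²`-orthogonal to the translation mode `φ₀'`, i.e. to the kernel
of the linearization `L₊`. This fixes the splitting of a kink mode into profile and position. -/
def OrthogonalToTranslation (φ₀ ψ : ℝ → ℝ) : Prop :=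
  ∫ x, deriv φ₀ x * (ψ x - φ₀ x) = 0

/-! A kink mode is a heteroclinic orbit from `-√q₀` to `√q₀` of `Φ'' = g(Φ) + 2εVΦ`, where `g(u) =
2(f(u²) - f(q₀))u` is odd with `g'(√q₀) > 0`. Let `k` be the kink translated to `s₀` and `p = k'`.
The linearization `w'' - g'(k)w` has the bounded kernel spanned by `p`, so the implicit function
theorem does not apply directly, and the usual bifurcation equation degenerates at `ε = 0`.

The degeneracy is removed by an exact identity. Multiplying the equation by `Φ'` and integrating,
the conservative part contributes nothing, because the primitive of `g` is even; hence `ε ∫ V Φ Φ' =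
0` along every heteroclinic orbit. For `ε ≠ 0` the factor `ε` can be dropped, and `∫ V Φ Φ' = 0` is
imposed as an extra scalar equation for all `ε`, while a multiplier `-c p` is allowed in the
differential equation. At `Φ = k` the scalar equation reads `M'(s₀)/2 = 0`, and its derivative along
`p` is `-M''(s₀)/2 ≠ 0`. The bordered problem is therefore nondegenerate at `ε = 0` and has a unique
Lipschitz branch (`IsHeteroclinic.exists_branch`, resting on `exists_solution_operator` and
`exists_implicit_branch`).

Solutions on the branch converge exponentially to the equilibria by comparison
(`exists_rightDecay_of_near`). The energy identity then reduces to `c ∫ p Φ' = 0` with a positive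
integral, so `c = 0` and the solutions are kink modes (`multiplier_eq_zero`). Conversely, a kink
mode with `ε ≠ 0` near `k` solves the bordered problem with `c = 0` (`integral_potential_eq_zero`),
so it lies on the branch.

The position is recovered last: the overlap `∫ p₀(x)(Φ(x + s) - φ₀(x)) dx`, with `p₀ = φ₀'`, is
strictly increasing in `s` near `s₀`, so it vanishes at exactly one nearby `s`
(`exists_displacement_slope`, `exists_displacement_eq_zero`). -/

open scoped BoundedContinuousFunction

/-! ### One-sided exponential decay and limits at infinity -/

/-- `z` decays exponentially at `+∞` (and grows at most exponentially at `-∞`). -/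
def RightDecay (z : ℝ → ℝ) : Prop :=
  ∃ C κ : ℝ, 0 < κ ∧ ∀ x, |z x| ≤ C * Real.exp (-κ * x)

namespace RightDecay

variable {y z : ℝ → ℝ}

theorem tendsto (hz : RightDecay z) : Tendsto z atTop (𝓝 0) := by
  obtain ⟨C, κ, hκ, h⟩ := hz
  have h1 : Tendsto (fun x : ℝ => C * Real.exp (-κ * x)) atTop (𝓝 (C * 0)) :=
    (Real.tendsto_exp_atBot.comp
      (tendsto_id.const_mul_atTop_of_neg (neg_neg_iff_pos.2 hκ))).const_mul C
  rw [mul_zero] at h1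
  exact squeeze_zero_norm h h1

theorem of_le {B : ℝ} (hz : RightDecay z) (h : ∀ x, |y x| ≤ B * |z x|) : RightDecay y := by
  obtain ⟨C, κ, hκ, h'⟩ := hz
  refine ⟨|B| * C, κ, hκ, fun x => (h x).trans ?_⟩
  calc B * |z x| ≤ |B| * |z x| := by gcongr; exact le_abs_self B
    _ ≤ |B| * (C * Real.exp (-κ * x)) := by gcongr; exact h' x
    _ = _ := by ring

/-- Growth at `-∞` is permitted, so left of `X` a plain bound on `z` suffices once the constant is
enlarged to `B e^{κX}`. -/
theorem of_eventually {B C κ X : ℝ} (hκ : 0 < κ) (hB : ∀ x, |z x| ≤ B)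
    (h : ∀ x, X ≤ x → |z x| ≤ C * Real.exp (-κ * x)) : RightDecay z := by
  refine ⟨max C (B * Real.exp (κ * X)), κ, hκ, fun x => ?_⟩
  have hB0 : 0 ≤ B := (abs_nonneg _).trans (hB 0)
  rcases le_total X x with hx | hx
  · exact (h x hx).trans (by gcongr; exact le_max_left _ _)
  · refine (hB x).trans ?_
    calc B = B * Real.exp (κ * X) * Real.exp (-κ * X) := by
          rw [mul_assoc, ← Real.exp_add]; simp
      _ ≤ max C (B * Real.exp (κ * X)) * Real.exp (-κ * x) := by
          have : -κ * X ≤ -κ * x := by nlinarith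
          gcongr
          exact le_max_right _ _

theorem add (hy : RightDecay y) (hz : RightDecay z) {B : ℝ} (hB : ∀ x, |y x + z x| ≤ B) :
    RightDecay (fun x => y x + z x) := by
  obtain ⟨C, κ, hκ, h⟩ := hy
  obtain ⟨C', κ', hκ', h'⟩ := hz
  refine of_eventually (X := 0) (C := C + C') (lt_min hκ hκ') hB fun x hx => ?_
  have e1 : Real.exp (-κ * x) ≤ Real.exp (-(min κ κ') * x) :=
    Real.exp_le_exp.2 (by nlinarith [min_le_left κ κ'])
  have e2 : Real.exp (-κ' * x) ≤ Real.exp (-(min κ κ') * x) :=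
    Real.exp_le_exp.2 (by nlinarith [min_le_right κ κ'])
  have hC : 0 ≤ C := by have := (abs_nonneg _).trans (h 0); simpa using this
  have hC' : 0 ≤ C' := by have := (abs_nonneg _).trans (h' 0); simpa using this
  calc |y x + z x| ≤ |y x| + |z x| := abs_add_le _ _
    _ ≤ C * Real.exp (-κ * x) + C' * Real.exp (-κ' * x) := add_le_add (h x) (h' x)
    _ ≤ C * Real.exp (-(min κ κ') * x) + C' * Real.exp (-(min κ κ') * x) := by gcongr
    _ = _ := by ring

theorem neg (hz : RightDecay z) : RightDecay (fun x => -z x) :=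
  hz.of_le (B := 1) fun x => by simp

theorem integrable (hc : Continuous z) (hr : RightDecay z) (hl : RightDecay fun x => z (-x)) :
    MeasureTheory.Integrable z := by
  have key : ∀ u : ℝ → ℝ, Continuous u → RightDecay u →
      MeasureTheory.IntegrableOn u (Set.Ioi 0) := by
    rintro u hu ⟨C, κ, hκ, h⟩
    refine integrable_of_isBigO_exp_neg hκ hu.continuousOn ?_
    exact Asymptotics.IsBigO.of_bound C (Eventually.of_forall fun x => by
      simpa [abs_of_pos (Real.exp_pos _)] using h x)
  rw [← MeasureTheory.integrableOn_univ, ← Set.Iic_union_Ioi (a := (0 : ℝ)),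
    MeasureTheory.integrableOn_union]
  refine ⟨?_, key z hc hr⟩
  have := key _ (hc.comp continuous_neg) hl
  have h2 := (MeasureTheory.Measure.measurePreserving_neg
    (MeasureTheory.volume : MeasureTheory.Measure ℝ)).integrableOn_comp_preimage
    (Homeomorph.neg ℝ).measurableEmbedding (f := z) (s := Set.Iic 0)
  have h3 : (Neg.neg ⁻¹' Set.Iic 0 : Set ℝ) = Set.Ici 0 := by ext x; simp
  rw [h3, integrableOn_Ici_iff_integrableOn_Ioi] at h2
  simpa using h2.1 this

end RightDecay

theorem exists_abs_le_of_tendsto {u : ℝ → ℝ} (hu : Continuous u) {l r : ℝ}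
    (hr : Tendsto u atTop (𝓝 r)) (hl : Tendsto u atBot (𝓝 l)) : ∃ B, ∀ x, |u x| ≤ B := by
  have h1 := hr.abs.eventually (gt_mem_nhds (lt_add_one |r|))
  have h2 := hl.abs.eventually (gt_mem_nhds (lt_add_one |l|))
  obtain ⟨b, hb⟩ := eventually_atTop.1 h1
  obtain ⟨c, hc⟩ := eventually_atBot.1 h2
  obtain ⟨B, hB⟩ := (isCompact_Icc (a := c) (b := b)).exists_bound_of_continuousOn hu.continuousOn
  refine ⟨max B (max (|r| + 1) (|l| + 1)), fun x => ?_⟩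
  rcases le_total b x with h | h
  · exact (hb x h).le.trans (by simp)
  rcases le_total x c with h' | h'
  · exact (hc x h').le.trans (by simp)
  · exact (hB x ⟨h', h⟩).trans (by simp)

/-- Two mean value steps: `u(x+1) - u(x) = u'(c)` is small because `u` converges, and `u'(c) - u'(x)
= u''(d)(c - x)` is small because `u''` tends to zero and `c - x ≤ 1`. -/
theorem tendsto_deriv_zero {u u' u'' : ℝ → ℝ} {l : ℝ} (hu : ∀ x, HasDerivAt u (u' x) x)
    (hu' : ∀ x, HasDerivAt u' (u'' x) x) (hl : Tendsto u atTop (𝓝 l))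
    (h0 : Tendsto u'' atTop (𝓝 0)) : Tendsto u' atTop (𝓝 0) := by
  have h1 : Tendsto (fun x => u (x + 1) - u x) atTop (𝓝 0) := by
    simpa using (hl.comp (tendsto_atTop_add_const_right _ 1 tendsto_id)).sub hl
  rw [Metric.tendsto_atTop] at *
  intro ε hε
  obtain ⟨N, hN⟩ := h0 (ε / 2) (half_pos hε)
  obtain ⟨N', hN'⟩ := h1 (ε / 2) (half_pos hε)
  refine ⟨max N N', fun x hx => ?_⟩
  obtain ⟨c, hc, hc'⟩ := exists_hasDerivAt_eq_slope u u' (lt_add_one x)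
    (HasDerivAt.continuousOn fun y _ => hu y) (fun y _ => hu y)
  have h2 := hN' x (le_of_max_le_right hx)
  simp only [add_sub_cancel_left, div_one] at hc'
  rw [← hc', dist_zero_right] at h2
  obtain ⟨d, hd, hd'⟩ := exists_hasDerivAt_eq_slope u' u'' hc.1
    (HasDerivAt.continuousOn fun y _ => hu' y) (fun y _ => hu' y)
  have h3 := hN d ((le_of_max_le_left hx).trans hd.1.le)
  rw [dist_zero_right] at h3 ⊢
  have h4 : u' c - u' x = u'' d * (c - x) := by
    rw [hd']; field_simp [sub_ne_zero.2 hc.1.ne']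
  have h5 : |u' c - u' x| ≤ ε / 2 := by
    rw [h4, abs_mul, abs_of_pos (sub_pos.2 hc.1)]
    have : c - x ≤ 1 := by linarith [hc.2]
    have h6 : |u'' d| < ε / 2 := h3
    nlinarith [abs_nonneg (u'' d), sub_pos.2 hc.1]
  have h7 : |u' c| < ε / 2 := h2
  rw [Real.norm_eq_abs, abs_lt]
  rw [abs_le] at h5
  rw [abs_lt] at h7
  constructor <;> linarith [h5.1, h5.2, h7.1, h7.2]

/-! ### Comparison principle and convergence to a saddle equilibrium -/

/-- At a local maximum the second derivative test would also give a local minimum, so `z` would be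
locally constant and `z''` would vanish there. -/
theorem not_isLocalMax_of_hasDerivAt_pos {z z' z'' : ℝ → ℝ} {x : ℝ}
    (hz : ∀ y, HasDerivAt z (z' y) y) (hz' : ∀ y, HasDerivAt z' (z'' y) y) (h : 0 < z'' x) :
    ¬ IsLocalMax z x := by
  intro hm
  have e1 : deriv z = z' := funext fun y => (hz y).deriv
  have e2 : deriv z' = z'' := funext fun y => (hz' y).deriv
  have hmin : IsLocalMin z x := isLocalMin_of_deriv_deriv_pos (by rw [e1, e2]; exact h)
    hm.deriv_eq_zero (hz x).continuousAt
  have hc : z =ᶠ[𝓝 x] fun _ => z x := by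
    filter_upwards [hm, hmin] with y h1 h2 using le_antisymm h1 h2
  have h3 := hc.deriv.deriv_eq
  rw [e1, e2] at h3
  simp at h3
  exact h.ne' h3

/-- A bounded subsolution of `w'' = m w - R e^{-κ x}` decays exponentially. -/
theorem exists_le_exp_of_subsolution {w w' w'' : ℝ → ℝ} {m R κ B X : ℝ}
    (hw : ∀ x, HasDerivAt w (w' x) x) (hw' : ∀ x, HasDerivAt w' (w'' x) x)
    (hm : 0 < m) (hκ : 0 < κ) (hX : 0 ≤ X) (hR : 0 ≤ R) (hB : ∀ x, w x ≤ B)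
    (hsub : ∀ x, X ≤ x → 0 < w x → m * w x - R * Real.exp (-κ * x) ≤ w'' x) :
    ∃ C ν : ℝ, 0 < ν ∧ ∀ x, X ≤ x → w x ≤ C * Real.exp (-ν * x) := by
  -- With `ν² ≤ m/2` the barrier uses at most half of the coefficient `m`; the other half absorbs
  -- the forcing, which is why `C ≥ 2R/m`. The other lower bound on `C` places the barrier above `w`
  -- at `X`.
  set ν := min κ (√(m / 2)) with hν
  have hν0 : 0 < ν := lt_min hκ (Real.sqrt_pos.2 (by positivity))
  have hν2 : ν ^ 2 ≤ m / 2 := by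
    calc ν ^ 2 ≤ √(m / 2) ^ 2 := by gcongr; exact min_le_right _ _
      _ = m / 2 := Real.sq_sqrt (by positivity)
  set C := max (B * Real.exp (ν * X)) (2 * R / m) with hC
  have hC1 : B * Real.exp (ν * X) ≤ C := le_max_left _ _
  have hC2 : 2 * R / m ≤ C := le_max_right _ _
  have hC0 : 0 ≤ C := le_trans (by positivity) hC2
  refine ⟨C, ν, hν0, fun x hx => ?_⟩
  -- The growing term `η e^{νx}` eventually exceeds `B`, so a positive maximum of `w` minus the
  -- barrier would be interior to some `[X, Y]`, where its second derivative is positive. Finally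
  -- `η` is sent to zero.
  have key : ∀ η : ℝ, 0 < η → w x ≤ C * Real.exp (-ν * x) + η * Real.exp (ν * x) := by
    intro η hη
    set z : ℝ → ℝ := fun y => w y - (C * Real.exp (-ν * y) + η * Real.exp (ν * y)) with hz
    set z' : ℝ → ℝ := fun y => w' y - (C * (Real.exp (-ν * y) * (-ν)) + η * (Real.exp (ν * y) * ν))
    set z'' : ℝ → ℝ := fun y => w'' y -
      (C * (Real.exp (-ν * y) * (-ν) * (-ν)) + η * (Real.exp (ν * y) * ν * ν)) with hz''
    have hlin : ∀ a y : ℝ, HasDerivAt (fun y => Real.exp (a * y)) (Real.exp (a * y) * a) y := by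
      intro a y
      simpa using ((hasDerivAt_id y).const_mul a).exp
    have hzd : ∀ y, HasDerivAt z (z' y) y := fun y =>
      (hw y).sub (((hlin (-ν) y).const_mul C).add ((hlin ν y).const_mul η))
    have hzd' : ∀ y, HasDerivAt z' (z'' y) y := fun y =>
      (hw' y).sub ((((hlin (-ν) y).mul_const (-ν)).const_mul C).add
        (((hlin ν y).mul_const ν).const_mul η))
    by_contra! hcon
    have hpos : 0 < z x := by simp only [hz]; linarith
    have hlim : ∀ᶠ y in atTop, B < η * Real.exp (ν * y) :=
      ((Real.tendsto_exp_atTop.comp (tendsto_id.const_mul_atTop hν0)).const_mul_atTop hη).eventually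
        (eventually_gt_atTop B)
    obtain ⟨Y, hY, hYx⟩ := (hlim.and (eventually_gt_atTop x)).exists
    have hzY : z Y < 0 := by
      have := hB Y
      have h1 : 0 ≤ C * Real.exp (-ν * Y) := by positivity
      simp only [hz]; linarith
    have hzX : z X < 0 := by
      have h1 : B ≤ C * Real.exp (-ν * X) := by
        calc B = B * Real.exp (ν * X) * Real.exp (-ν * X) := by
              rw [mul_assoc, ← Real.exp_add]; simp
          _ ≤ C * Real.exp (-ν * X) := by gcongr
      have h2 : 0 < η * Real.exp (ν * X) := by positivity
      have := hB X
      simp only [hz]; linarith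
    have hzc : Continuous z := continuous_iff_continuousAt.2 fun y => (hzd y).continuousAt
    obtain ⟨c, hc, hcmax⟩ := (isCompact_Icc (a := X) (b := Y)).exists_isMaxOn
      ⟨x, hx, hYx.le⟩ hzc.continuousOn
    have hzcpos : 0 < z c := hpos.trans_le (hcmax ⟨hx, hYx.le⟩)
    have hcX : X < c := lt_of_le_of_ne hc.1 fun h => by rw [← h] at hzcpos; linarith
    have hcY : c < Y := lt_of_le_of_ne hc.2 fun h => by rw [h] at hzcpos; linarith
    refine not_isLocalMax_of_hasDerivAt_pos hzd hzd' ?_ (hcmax.isLocalMax (Icc_mem_nhds hcX hcY))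
    have e1 : 0 < Real.exp (-ν * c) := Real.exp_pos _
    have e2 : 0 < η * Real.exp (ν * c) := by positivity
    have e3 : Real.exp (-κ * c) ≤ Real.exp (-ν * c) :=
      Real.exp_le_exp.2 (by nlinarith [min_le_left κ (√(m / 2))])
    have h1 : C * Real.exp (-ν * c) + η * Real.exp (ν * c) < w c := by
      simp only [hz] at hzcpos; linarith
    have h2 : 0 ≤ C * Real.exp (-ν * c) := by positivity
    have h3 := hsub c hcX.le (by linarith)
    have h4 : R * Real.exp (-κ * c) ≤ m / 2 * (C * Real.exp (-ν * c)) := by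
      have : R ≤ m / 2 * C := by
        rw [div_le_iff₀ hm] at hC2; linarith
      calc R * Real.exp (-κ * c) ≤ (m / 2 * C) * Real.exp (-ν * c) := by gcongr
        _ = _ := by ring
    have h5 : ν ^ 2 * (C * Real.exp (-ν * c) + η * Real.exp (ν * c)) ≤
        m / 2 * (C * Real.exp (-ν * c) + η * Real.exp (ν * c)) := by gcongr
    simp only [hz'']
    nlinarith
  refine le_of_forall_pos_le_add fun δ hδ => ?_
  have := key (δ * Real.exp (-ν * x)) (by positivity)
  rwa [mul_assoc, ← Real.exp_add, neg_mul, neg_add_cancel, Real.exp_zero, mul_one, ← neg_mul] at this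

/-- Near a nondegenerate zero a `C¹` function is comparable to its linearization. -/
theorem exists_slope_bounds {g : ℝ → ℝ} {a : ℝ} (hg : ContDiff ℝ 1 g) (ha : g a = 0)
    (hd : 0 < deriv g a) :
    ∃ r m M : ℝ, 0 < r ∧ 0 < m ∧ m ≤ M ∧
      ∀ u, |u - a| ≤ r → ∃ b, m ≤ b ∧ b ≤ M ∧ g u = b * (u - a) := by
  have hc : Continuous (deriv g) := hg.continuous_deriv le_rfl
  have h1 : ∀ᶠ u in 𝓝 a, deriv g a / 2 < deriv g u ∧ deriv g u < 2 * deriv g a :=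
    (hc.continuousAt.eventually (lt_mem_nhds (by linarith))).and
      (hc.continuousAt.eventually (gt_mem_nhds (by linarith)))
  obtain ⟨r, hr, h2⟩ := Metric.eventually_nhds_iff_ball.1 h1
  refine ⟨r / 2, deriv g a / 2, 2 * deriv g a, by positivity, by positivity, by linarith,
    fun u hu => ?_⟩
  have hdiff := hg.differentiable one_ne_zero
  have hball : ∀ v, |v - a| ≤ |u - a| → v ∈ Metric.ball a r := fun v hv => by
    rw [Metric.mem_ball, Real.dist_eq]; linarith
  rcases lt_trichotomy u a with h | h | h
  · obtain ⟨c, hc, hc'⟩ := exists_deriv_eq_slope g h hdiff.continuous.continuousOn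
      hdiff.differentiableOn
    have := h2 c (hball c (by
      rw [abs_of_neg (by linarith [hc.2]), abs_of_neg (by linarith)]; linarith [hc.1]))
    refine ⟨deriv g c, this.1.le, this.2.le, ?_⟩
    rw [hc', ha]; field_simp [sub_ne_zero.2 h.ne']; ring
  · exact ⟨deriv g a, by linarith, by linarith, by rw [h, ha]; simp⟩
  · obtain ⟨c, hc, hc'⟩ := exists_deriv_eq_slope g h hdiff.continuous.continuousOn
      hdiff.differentiableOn
    have := h2 c (hball c (by
      rw [abs_of_pos (by linarith [hc.1]), abs_of_pos (by linarith)]; linarith [hc.2]))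
    refine ⟨deriv g c, this.1.le, this.2.le, ?_⟩
    rw [hc', ha, sub_zero, div_mul_cancel₀ _ (sub_ne_zero.2 h.ne')]

/-- A bounded solution of `Φ'' = g(Φ) + ρ` which stays close to a nondegenerate equilibrium `a`
converges to it exponentially fast, if `ρ` decays exponentially. -/
theorem rightDecay_sub_of_near_equilibrium {g Φ Φ' ρ : ℝ → ℝ} {a r m M B X : ℝ}
    (hm : 0 < m) (hg : ∀ u, |u - a| ≤ r → ∃ b, m ≤ b ∧ b ≤ M ∧ g u = b * (u - a))
    (hΦ : ∀ x, HasDerivAt Φ (Φ' x) x) (hΦ' : ∀ x, HasDerivAt Φ' (g (Φ x) + ρ x) x)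
    (hρ : RightDecay ρ) (hB : ∀ x, |Φ x| ≤ B) (hX : ∀ x, X ≤ x → |Φ x - a| ≤ r) :
    RightDecay (fun x => Φ x - a) := by
  obtain ⟨R, κ, hκ, hR⟩ := hρ
  have hR0 : 0 ≤ R := by have := (abs_nonneg _).trans (hR 0); simpa using this
  have hB' : ∀ x, |Φ x - a| ≤ B + |a| := fun x => (abs_sub _ _).trans (by gcongr; exact hB x)
  obtain ⟨C₁, ν₁, hν₁, h₁⟩ := exists_le_exp_of_subsolution (w := fun x => Φ x - a) (X := max X 0)
    (fun x => (hΦ x).sub_const a) hΦ' hm hκ (le_max_right _ _) hR0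
    (fun x => (le_abs_self _).trans (hB' x)) (fun x hx hpos => by
      obtain ⟨b, hb, -, hgb⟩ := hg _ (hX x ((le_max_left _ _).trans hx))
      rw [hgb]
      have := (abs_le.1 (hR x)).1
      nlinarith)
  obtain ⟨C₂, ν₂, hν₂, h₂⟩ := exists_le_exp_of_subsolution (w := fun x => -(Φ x - a))
    (X := max X 0)
    (fun x => ((hΦ x).sub_const a).neg) (fun x => (hΦ' x).neg) hm hκ (le_max_right _ _) hR0
    (fun x => (neg_le_abs _).trans (hB' x)) (fun x hx hpos => by
      obtain ⟨b, hb, -, hgb⟩ := hg _ (hX x ((le_max_left _ _).trans hx))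
      rw [hgb]
      have := (abs_le.1 (hR x)).2
      nlinarith)
  refine RightDecay.of_eventually (X := max X 0) (C := max |C₁| |C₂|) (lt_min hν₁ hν₂) hB'
    fun x hx => ?_
  have hx0 : 0 ≤ x := (le_max_right _ _).trans hx
  have e1 : Real.exp (-ν₁ * x) ≤ Real.exp (-(min ν₁ ν₂) * x) :=
    Real.exp_le_exp.2 (by nlinarith [min_le_left ν₁ ν₂])
  have e2 : Real.exp (-ν₂ * x) ≤ Real.exp (-(min ν₁ ν₂) * x) :=
    Real.exp_le_exp.2 (by nlinarith [min_le_right ν₁ ν₂])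
  have aux : ∀ C ν : ℝ, |C| ≤ max |C₁| |C₂| → Real.exp (-ν * x) ≤ Real.exp (-(min ν₁ ν₂) * x) →
      C * Real.exp (-ν * x) ≤ max |C₁| |C₂| * Real.exp (-(min ν₁ ν₂) * x) := fun C ν hC he =>
    calc C * Real.exp (-ν * x) ≤ |C| * Real.exp (-ν * x) := by gcongr; exact le_abs_self C
      _ ≤ _ := by gcongr
  rw [abs_le']
  exact ⟨(h₁ x hx).trans (aux _ _ (le_max_left _ _) e1),
    (h₂ x hx).trans (aux _ _ (le_max_right _ _) e2)⟩

/-! ### The kink: monotonicity and tail estimates -/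

/-- An odd `C¹` nonlinearity with a nondegenerate saddle equilibrium at `a > 0`. -/
structure OddBistable (g : ℝ → ℝ) (a : ℝ) : Prop where
  contDiff : ContDiff ℝ 1 g
  odd : ∀ u, g (-u) = -g u
  pos : 0 < a
  zero : g a = 0
  deriv_pos : 0 < deriv g a

/-- `k` is a heteroclinic solution of `k'' = g k` connecting `-a` to `a`, and `p = k'`. -/
structure IsHeteroclinic (g : ℝ → ℝ) (a : ℝ) (k p : ℝ → ℝ) : Prop where
  hasDerivAt : ∀ x, HasDerivAt k (p x) x
  hasDerivAt' : ∀ x, HasDerivAt p (g (k x)) x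
  right : RightDecay (fun x => k x - a)
  left : RightDecay (fun x => k (-x) + a)

theorem nonneg_of_deriv_nonpos_of_tendsto_zero {E E' : ℝ → ℝ} {X : ℝ}
    (hE : ∀ x, HasDerivAt E (E' x) x) (hneg : ∀ x, X ≤ x → E' x ≤ 0)
    (hlim : Tendsto E atTop (𝓝 0)) {x : ℝ} (hx : X ≤ x) : 0 ≤ E x := by
  have hanti : AntitoneOn E (Set.Ici X) := antitoneOn_of_deriv_nonpos (convex_Ici X)
    (HasDerivAt.continuousOn fun y _ => hE y) (fun y _ => (hE y).differentiableAt.differentiableWithinAt)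
    (fun y hy => by
      rw [interior_Ici] at hy
      rw [(hE y).deriv]
      exact hneg y (le_of_lt hy))
  refine le_of_tendsto hlim ?_
  filter_upwards [eventually_ge_atTop x] with y hy
  exact hanti hx (hx.trans hy) hy

namespace IsHeteroclinic

variable {g k p : ℝ → ℝ} {a : ℝ}

theorem reflect (N : OddBistable g a) (K : IsHeteroclinic g a k p) :
    IsHeteroclinic g a (fun x => -k (-x)) (fun x => p (-x)) where
  hasDerivAt x := by
    convert! ((K.hasDerivAt (-x)).comp x (hasDerivAt_neg x)).neg using 1
    simp
  hasDerivAt' x := by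
    convert! (K.hasDerivAt' (-x)).comp x (hasDerivAt_neg x) using 1
    simp [N.odd]
  right := K.left.neg.of_le (B := 1) fun x => by
    rw [one_mul, neg_add']
  left := K.right.neg.of_le (B := 1) fun x => by
    rw [one_mul, neg_neg, neg_sub', sub_neg_eq_add]

theorem continuous (K : IsHeteroclinic g a k p) : Continuous k :=
  continuous_iff_continuousAt.2 fun x => (K.hasDerivAt x).continuousAt

theorem continuous' (K : IsHeteroclinic g a k p) : Continuous p :=
  continuous_iff_continuousAt.2 fun x => (K.hasDerivAt' x).continuousAt

theorem tendsto_atTop (K : IsHeteroclinic g a k p) : Tendsto k atTop (𝓝 a) := by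
  simpa using K.right.tendsto.add_const a

theorem tendsto_atBot (K : IsHeteroclinic g a k p) : Tendsto k atBot (𝓝 (-a)) := by
  simpa [Function.comp_def] using (K.left.tendsto.comp tendsto_neg_atBot_atTop).sub_const a

theorem deriv_tendsto_atTop (N : OddBistable g a) (K : IsHeteroclinic g a k p) :
    Tendsto p atTop (𝓝 0) := by
  refine tendsto_deriv_zero K.hasDerivAt K.hasDerivAt' K.tendsto_atTop ?_
  have := (N.contDiff.continuous.tendsto a).comp K.tendsto_atTop
  rwa [N.zero] at this

theorem deriv_tendsto_atBot (N : OddBistable g a) (K : IsHeteroclinic g a k p) :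
    Tendsto p atBot (𝓝 0) := by
  simpa [Function.comp_def] using
    ((K.reflect N).deriv_tendsto_atTop N).comp tendsto_neg_atBot_atTop

theorem exists_bound (K : IsHeteroclinic g a k p) : ∃ B, ∀ x, |k x| ≤ B :=
  exists_abs_le_of_tendsto K.continuous K.tendsto_atTop K.tendsto_atBot

/-- If `p x₁ = 0`, then `k(x₁ + t)` and `k(x₁ - t)` solve the same Cauchy problem. Uniqueness makes
`k` symmetric about `x₁`, against its distinct limits. The orbit stays in a compact box, on which
the `C¹` vector field is Lipschitz. -/
theorem deriv_ne_zero (N : OddBistable g a) (K : IsHeteroclinic g a k p) (x₁ : ℝ) : p x₁ ≠ 0 := by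
  intro h0
  obtain ⟨B, hB⟩ := K.exists_bound
  obtain ⟨B', hB'⟩ := exists_abs_le_of_tendsto K.continuous' (K.deriv_tendsto_atTop N)
    (K.deriv_tendsto_atBot N)
  have hv : ContDiff ℝ 1 (fun z : ℝ × ℝ => (z.2, g z.1)) :=
    contDiff_snd.prodMk (N.contDiff.comp contDiff_fst)
  obtain ⟨L, hL⟩ := hv.contDiffOn.exists_lipschitzOnWith (s := Set.Icc (-B) B ×ˢ Set.Icc (-B') B')
    one_ne_zero ((convex_Icc _ _).prod (convex_Icc _ _)) (isCompact_Icc.prod isCompact_Icc)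
  have hmem : ∀ x, (k x, p x) ∈ Set.Icc (-B) B ×ˢ Set.Icc (-B') B' := fun x =>
    ⟨abs_le.1 (hB x), abs_le.1 (hB' x)⟩
  have hmem' : ∀ x, (k x, -p x) ∈ Set.Icc (-B) B ×ˢ Set.Icc (-B') B' := fun x =>
    ⟨abs_le.1 (hB x), abs_le.1 (by rw [abs_neg]; exact hB' x)⟩
  have heq := ODE_solution_unique_univ (v := fun _ z => (z.2, g z.1)) (t₀ := 0)
    (f := fun t => (k (x₁ + t), p (x₁ + t))) (g := fun t => (k (x₁ - t), -p (x₁ - t)))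
    (fun _ => hL)
    (fun t => ⟨((K.hasDerivAt (x₁ + t)).comp_const_add x₁ t).prodMk
      ((K.hasDerivAt' (x₁ + t)).comp_const_add x₁ t), hmem _⟩)
    (fun t => ⟨by
      simpa using ((K.hasDerivAt (x₁ - t)).comp_const_sub x₁ t).prodMk
        ((K.hasDerivAt' (x₁ - t)).comp_const_sub x₁ t).neg, hmem' _⟩)
    (by simp [h0])
  have h1 : ∀ t, k (x₁ + t) = k (x₁ - t) := fun t => congrArg Prod.fst (congrFun heq t)
  have l1 : Tendsto (fun t => k (x₁ + t)) atTop (𝓝 a) :=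
    K.tendsto_atTop.comp (tendsto_atTop_add_const_left _ x₁ tendsto_id)
  have l2 : Tendsto (fun t => k (x₁ - t)) atTop (𝓝 (-a)) :=
    K.tendsto_atBot.comp ((tendsto_atBot_add_const_left atTop x₁ tendsto_neg_atTop_atBot).congr
      fun t => (sub_eq_add_neg _ _).symm)
  simp_rw [h1] at l1
  have := tendsto_nhds_unique l1 l2
  linarith [N.pos]

theorem deriv_pos (N : OddBistable g a) (K : IsHeteroclinic g a k p) (x : ℝ) : 0 < p x := by
  by_contra! hx
  have hex : ∃ y, 0 ≤ p y := by
    by_contra! hneg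
    have hanti : Antitone k := antitone_of_deriv_nonpos
      (fun y => (K.hasDerivAt y).differentiableAt) fun y => by
        rw [(K.hasDerivAt y).deriv]; exact (hneg y).le
    have h1 : a ≤ k 0 := le_of_tendsto K.tendsto_atTop
      ((eventually_ge_atTop 0).mono fun y hy => hanti hy)
    have h2 : k 0 ≤ -a := ge_of_tendsto K.tendsto_atBot
      ((eventually_le_atBot 0).mono fun y hy => hanti hy)
    linarith [N.pos]
  obtain ⟨y, hy⟩ := mem_range_of_exists_le_of_exists_ge K.continuous' ⟨x, hx⟩ hex
  exact K.deriv_ne_zero N y hy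

theorem strictMono (N : OddBistable g a) (K : IsHeteroclinic g a k p) : StrictMono k :=
  strictMono_of_deriv_pos fun y => by rw [(K.hasDerivAt y).deriv]; exact K.deriv_pos N y

theorem lt (N : OddBistable g a) (K : IsHeteroclinic g a k p) (x : ℝ) : k x < a :=
  (K.strictMono N (lt_add_one x)).trans_le
    ((K.strictMono N).monotone.ge_of_tendsto K.tendsto_atTop _)

/-- On the right tail the derivative of the kink is comparable to its distance to `a`. -/
theorem exists_tail_bounds (N : OddBistable g a) (K : IsHeteroclinic g a k p) :
    ∃ X c ν D : ℝ, 0 ≤ X ∧ 0 < c ∧ 0 < ν ∧ 0 < D ∧ ∀ x, X ≤ x →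
      c * (a - k x) ≤ p x ∧ p x ≤ D * (a - k x) ∧ g (k x) ≤ -ν * p x ∧
        |g (k x)| ≤ D * (a - k x) := by
  obtain ⟨r, m, M, hr, hm, hmM, hb⟩ := exists_slope_bounds N.contDiff N.zero N.deriv_pos
  have hM : 0 < M := hm.trans_le hmM
  obtain ⟨X₀, hX₀⟩ := eventually_atTop.1
    (K.tendsto_atTop.eventually (Metric.closedBall_mem_nhds a hr))
  have hX : ∀ x, max X₀ 0 ≤ x → |k x - a| ≤ r := fun x hx => hX₀ x ((le_max_left _ _).trans hx)
  -- The quantity `p² - c(a - k)²` vanishes at infinity and has derivative `2p(g(k) + c(a - k))`.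
  -- Near `a` this is nonpositive for `c = m` and nonnegative for `c = M`, which pinches `p` between
  -- `√m (a - k)` and `√M (a - k)`.
  have hlim : ∀ c : ℝ, Tendsto (fun x => p x ^ 2 - c * (a - k x) ^ 2) atTop (𝓝 0) := fun c => by
    simpa using ((K.deriv_tendsto_atTop N).pow 2).sub
      (((tendsto_const_nhds (x := a)).sub K.tendsto_atTop).pow 2 |>.const_mul c)
  have hder : ∀ c x : ℝ, HasDerivAt (fun x => p x ^ 2 - c * (a - k x) ^ 2)
      (2 * p x * (g (k x) + c * (a - k x))) x := fun c x => by
    convert! ((K.hasDerivAt' x).pow 2).sub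
      ((((K.hasDerivAt x).const_sub a).pow 2).const_mul c) using 1
    push_cast; ring
  have h1 : ∀ x, max X₀ 0 ≤ x → m * (a - k x) ^ 2 ≤ p x ^ 2 := fun x hx => by
    refine sub_nonneg.1 (nonneg_of_deriv_nonpos_of_tendsto_zero (hder m) (fun y hy => ?_) (hlim m) hx)
    obtain ⟨b, hb1, -, hb2⟩ := hb _ (hX y hy)
    have := K.lt N y
    have hp := K.deriv_pos N y
    have h3 : g (k y) + m * (a - k y) ≤ 0 := by rw [hb2]; nlinarith
    exact mul_nonpos_of_nonneg_of_nonpos (by positivity) h3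
  have h2 : ∀ x, max X₀ 0 ≤ x → p x ^ 2 ≤ M * (a - k x) ^ 2 := fun x hx => by
    have := nonneg_of_deriv_nonpos_of_tendsto_zero (fun x => (hder M x).neg) (fun y hy => ?_)
      (by rw [← neg_zero]; exact (hlim M).neg) hx
    · simp only [Pi.neg_apply] at this; linarith
    obtain ⟨b, -, hb1, hb2⟩ := hb _ (hX y hy)
    have := K.lt N y
    have hp := K.deriv_pos N y
    have h3 : 0 ≤ g (k y) + M * (a - k y) := by rw [hb2]; nlinarith
    simp only [Left.neg_nonpos_iff]
    positivity
  have hsm := Real.sqrt_pos.2 hm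
  have hsM := Real.sqrt_pos.2 hM
  refine ⟨max X₀ 0, √m, m / √M, max (√M) M, le_max_right _ _, hsm, by positivity,
    lt_max_of_lt_right hM, fun x hx => ?_⟩
  have hk := sub_pos.2 (K.lt N x)
  have hp := K.deriv_pos N x
  have e1 : √m * (a - k x) ≤ p x := by
    refine le_of_sq_le_sq ?_ hp.le
    rw [mul_pow, Real.sq_sqrt hm.le]; exact h1 x hx
  have e2 : p x ≤ √M * (a - k x) := by
    refine le_of_sq_le_sq ?_ (by positivity)
    rw [mul_pow, Real.sq_sqrt hM.le]; exact h2 x hx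
  obtain ⟨b, hb1, hb2, hb3⟩ := hb _ (hX x hx)
  refine ⟨e1, e2.trans (by gcongr; exact le_max_left _ _), ?_, ?_⟩
  -- Here `g(k) ≤ -m(a - k) ≤ -(m/√M) p`, the origin of the rate `m / √M`.
  · rw [hb3, neg_mul, div_mul_eq_mul_div, ← neg_div, le_div_iff₀ hsM]
    nlinarith [mul_le_mul_of_nonneg_left e2 hm.le, mul_nonneg (sub_nonneg.2 hb1) (mul_pos hk hsM).le]
  · rw [hb3, abs_mul, abs_of_pos (hm.trans_le hb1), abs_sub_comm, abs_of_pos hk]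
    gcongr
    exact hb2.trans (le_max_right _ _)

theorem rightDecay_deriv (N : OddBistable g a) (K : IsHeteroclinic g a k p) : RightDecay p := by
  obtain ⟨X, c, ν, D, -, -, -, hD, h⟩ := K.exists_tail_bounds N
  obtain ⟨B, hB⟩ := exists_abs_le_of_tendsto K.continuous' (K.deriv_tendsto_atTop N)
    (K.deriv_tendsto_atBot N)
  obtain ⟨C, κ, hκ, hC⟩ := K.right
  refine RightDecay.of_eventually (X := X) (C := D * C) hκ hB fun x hx => ?_
  rw [abs_of_pos (K.deriv_pos N x), mul_assoc]
  refine (h x hx).2.1.trans ?_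
  gcongr
  refine le_trans ?_ (hC x)
  rw [abs_sub_comm]; exact le_abs_self _

/-- These are the estimates consumed by reduction of order. On a compact interval they hold by
continuity; on the tail the first two compare `p` with `a - k`. For the third, `p' ≤ -νp` makes
`1/p` grow fast enough to dominate its own integral. -/
theorem exists_right_bounds (N : OddBistable g a) (K : IsHeteroclinic g a k p) :
    ∃ C : ℝ, 0 < C ∧ ∀ x, 0 ≤ x → a - k x ≤ C * p x ∧ |g (k x)| ≤ C * p x ∧
      p x * ∫ y in (0 : ℝ)..x, (p y)⁻¹ ≤ C := by
  obtain ⟨X, c, ν, D, hX0, hc, hν, hD, h⟩ := K.exists_tail_bounds N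
  have hp := K.deriv_pos N
  have hpinv : Continuous fun y => (p y)⁻¹ := K.continuous'.inv₀ fun y => (hp y).ne'
  have hI : ∀ x, HasDerivAt (fun x => ∫ y in (0 : ℝ)..x, (p y)⁻¹) (p x)⁻¹ x := fun x =>
    (hpinv.integral_hasStrictDerivAt 0 x).hasDerivAt
  have hIc : Continuous fun x => ∫ y in (0 : ℝ)..x, (p y)⁻¹ :=
    continuous_iff_continuousAt.2 fun x => (hI x).continuousAt
  obtain ⟨B₁, hB₁⟩ := (isCompact_Icc (a := 0) (b := X)).exists_bound_of_continuousOn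
    (((continuous_const (y := a)).sub K.continuous).mul hpinv).continuousOn
  obtain ⟨B₂, hB₂⟩ := (isCompact_Icc (a := 0) (b := X)).exists_bound_of_continuousOn
    ((N.contDiff.continuous.comp K.continuous).mul hpinv).continuousOn
  obtain ⟨B₃, hB₃⟩ := (isCompact_Icc (a := 0) (b := X)).exists_bound_of_continuousOn
    (K.continuous'.mul hIc).continuousOn
  simp only [Real.norm_eq_abs, Pi.mul_apply, Pi.sub_apply, Function.comp_apply] at hB₁ hB₂ hB₃
  set C₃ := max (1 / ν) B₃
  set C := max (max (max B₁ (1 / c)) (max B₂ (D / c))) C₃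
  have hC3 : C₃ ≤ C := le_max_right _ _
  have i1 : B₁ ≤ C := by simp [C]
  have i2 : 1 / c ≤ C := (le_max_right B₁ _).trans ((le_max_left _ _).trans (le_max_left _ _))
  have i3 : B₂ ≤ C := by simp [C]
  have i4 : D / c ≤ C := (le_max_right B₂ _).trans ((le_max_right _ _).trans (le_max_left _ _))
  refine ⟨C, lt_of_lt_of_le (by positivity) i2, fun x hx => ?_⟩
  have hpx := hp x
  rcases le_total x X with hxX | hxX
  · refine ⟨?_, ?_, ?_⟩
    · have := (le_abs_self _).trans ((hB₁ x ⟨hx, hxX⟩).trans i1)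
      rwa [← div_eq_mul_inv, div_le_iff₀ hpx] at this
    · have := (hB₂ x ⟨hx, hxX⟩).trans i3
      rwa [abs_mul, abs_inv, abs_of_pos hpx, ← div_eq_mul_inv, div_le_iff₀ hpx] at this
    · exact (le_abs_self _).trans ((hB₃ x ⟨hx, hxX⟩).trans ((le_max_right _ _).trans hC3))
  · obtain ⟨h1, h2, h3, h4⟩ := h x hxX
    have e : a - k x ≤ p x / c := by rw [le_div_iff₀ hc]; linarith
    refine ⟨?_, ?_, ?_⟩
    · calc a - k x ≤ 1 / c * p x := by rwa [one_div_mul_eq_div]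
        _ ≤ C * p x := by gcongr
    · calc |g (k x)| ≤ D * (a - k x) := h4
        _ ≤ D * (p x / c) := by gcongr
        _ = D / c * p x := by ring
        _ ≤ C * p x := by gcongr
    · have hd : ∀ y, HasDerivAt (fun y => C₃ * (p y)⁻¹ - ∫ z in (0 : ℝ)..y, (p z)⁻¹)
          (C₃ * (-g (k y) / p y ^ 2) - (p y)⁻¹) y := fun y =>
        (((K.hasDerivAt' y).inv (hp y).ne').const_mul C₃).sub (hI y)
      -- The derivative is `(-C₃ g(k) - p)/p²`, nonnegative since `-g(k) ≥ νp` and `C₃ ≥ 1/ν`; the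
      -- term `B₃` in `C₃` gives the inequality at the starting point `X`.
      have hmono : MonotoneOn (fun y => C₃ * (p y)⁻¹ - ∫ z in (0 : ℝ)..y, (p z)⁻¹) (Set.Ici X) := by
        refine monotoneOn_of_deriv_nonneg (convex_Ici X) (HasDerivAt.continuousOn fun y _ => hd y)
          (fun y _ => (hd y).differentiableAt.differentiableWithinAt) fun y hy => ?_
        rw [interior_Ici] at hy
        rw [(hd y).deriv]
        have hpy := hp y
        have h5 := (h y (le_of_lt hy)).2.2.1
        have h6 : 1 / ν ≤ C₃ := le_max_left _ _
        rw [div_le_iff₀ hν] at h6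
        have h7 : C₃ * (-g (k y) / p y ^ 2) - (p y)⁻¹ = (C₃ * (-g (k y)) - p y) / p y ^ 2 := by
          field_simp
        rw [h7]
        refine div_nonneg ?_ (by positivity)
        have hC30 : 0 ≤ C₃ := le_trans (by positivity) (le_max_left _ _)
        nlinarith [mul_le_mul_of_nonneg_left h5 hC30]
      have h5 := hmono Set.self_mem_Ici hxX hxX
      have h6 : p X * ∫ y in (0 : ℝ)..X, (p y)⁻¹ ≤ C₃ :=
        (le_abs_self _).trans ((hB₃ X ⟨hX0, le_rfl⟩).trans (le_max_right _ _))
      have hpX := hp X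
      have h7 : ∫ y in (0 : ℝ)..X, (p y)⁻¹ ≤ C₃ * (p X)⁻¹ := by
        rw [← div_eq_mul_inv, le_div_iff₀ hpX]; linarith
      have h8 : ∫ y in (0 : ℝ)..x, (p y)⁻¹ ≤ C₃ * (p x)⁻¹ := by
        simp only at h5; linarith
      rw [← div_eq_mul_inv, le_div_iff₀ hpx] at h8
      linarith

theorem exists_bounds (N : OddBistable g a) (K : IsHeteroclinic g a k p) :
    ∃ C : ℝ, 0 < C ∧ (∀ x, |g (k x)| ≤ C * p x) ∧
      (∀ x, p x * |∫ y in (0 : ℝ)..x, (p y)⁻¹| ≤ C) ∧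
      (∀ x, 0 ≤ x → a - k x ≤ C * p x) ∧ ∀ x, x ≤ 0 → k x + a ≤ C * p x := by
  obtain ⟨C, hC, h⟩ := K.exists_right_bounds N
  obtain ⟨C', hC', h'⟩ := (K.reflect N).exists_right_bounds N
  have hp := K.deriv_pos N
  have m1 := le_max_left C C'
  have m2 := le_max_right C C'
  have aux : ∀ x {y c : ℝ}, y ≤ c * p x → c ≤ max C C' → y ≤ max C C' * p x := fun x y c h1 h2 =>
    h1.trans (mul_le_mul_of_nonneg_right h2 (hp x).le)
  refine ⟨max C C', lt_max_of_lt_left hC, fun x => ?_, fun x => ?_, fun x hx => ?_, fun x hx => ?_⟩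
  · rcases le_total 0 x with hx | hx
    · exact aux x (h x hx).2.1 m1
    · have := (h' (-x) (by linarith)).2.1
      simp only [neg_neg, N.odd, abs_neg] at this
      exact aux x this m2
  · rcases le_total 0 x with hx | hx
    · rw [abs_of_nonneg (intervalIntegral.integral_nonneg hx fun y _ => inv_nonneg.2 (hp y).le)]
      exact (h x hx).2.2.trans m1
    · have := (h' (-x) (by linarith)).2.2
      have e := intervalIntegral.integral_comp_neg (a := 0) (b := -x) fun y => (p y)⁻¹
      simp only [e, neg_neg, neg_zero] at this
      rw [intervalIntegral.integral_symm, abs_neg,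
        abs_of_nonneg (intervalIntegral.integral_nonneg hx fun y _ => inv_nonneg.2 (hp y).le)]
      exact this.trans m2
  · exact aux x (h x hx).1 m1
  · have := (h' (-x) (by linarith)).1
    simp only [neg_neg] at this
    exact aux x (by linarith) m2

theorem integrable_deriv (N : OddBistable g a) (K : IsHeteroclinic g a k p) :
    MeasureTheory.Integrable p :=
  RightDecay.integrable K.continuous' (K.rightDecay_deriv N) ((K.reflect N).rightDecay_deriv N)

end IsHeteroclinic

/-! ### Linear theory: solving the linearized equation in bounded functions -/

theorem exists_continuousLinearMap_of_bound {E : Type*} [NormedAddCommGroup E] [NormedSpace ℝ E]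
    (T : E →ₗ[ℝ] (ℝ → ℝ)) (hc : ∀ u, Continuous (T u)) (C : ℝ)
    (hb : ∀ u x, |T u x| ≤ C * ‖u‖) : ∃ S : E →L[ℝ] (ℝ →ᵇ ℝ), ∀ u x, S u x = T u x := by
  let L : E →ₗ[ℝ] (ℝ →ᵇ ℝ) :=
    { toFun := fun u => BoundedContinuousFunction.ofNormedAddCommGroup (T u) (hc u) (C * ‖u‖) (hb u)
      map_add' := fun u v => by ext x; simp
      map_smul' := fun c u => by ext x; simp }
  refine ⟨L.mkContinuous |C| fun u => ?_, fun u x => rfl⟩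
  refine (BoundedContinuousFunction.norm_le (by positivity)).2 fun x => (hb u x).trans ?_
  gcongr
  exact le_abs_self C

theorem integrable_mul_boundedContinuous {V : ℝ → ℝ} (hV : MeasureTheory.Integrable V)
    (u : ℝ →ᵇ ℝ) : MeasureTheory.Integrable fun x => V x * u x :=
  hV.mul_bdd (c := ‖u‖) u.continuous.aestronglyMeasurable
    (Eventually.of_forall fun x => u.norm_coe_le_norm x)

theorem exists_integral_continuousLinearMap {V : ℝ → ℝ} (hV : MeasureTheory.Integrable V) :
    ∃ I : (ℝ →ᵇ ℝ) →L[ℝ] ℝ, ∀ u, I u = ∫ x, V x * u x := by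
  let L : (ℝ →ᵇ ℝ) →ₗ[ℝ] ℝ :=
    { toFun := fun u => ∫ x, V x * u x
      map_add' := fun u v => by
        rw [← MeasureTheory.integral_add (integrable_mul_boundedContinuous hV u)
          (integrable_mul_boundedContinuous hV v)]
        simp [mul_add]
      map_smul' := fun c u => by
        rw [RingHom.id_apply, smul_eq_mul, ← MeasureTheory.integral_const_mul]
        simp [mul_left_comm] }
  refine ⟨L.mkContinuous (∫ x, ‖V x‖) fun u => ?_, fun u => rfl⟩
  calc ‖∫ x, V x * u x‖ ≤ ∫ x, ‖V x * u x‖ := MeasureTheory.norm_integral_le_integral_norm _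
    _ ≤ ∫ x, ‖V x‖ * ‖u‖ := by
        refine MeasureTheory.integral_mono (integrable_mul_boundedContinuous hV u).norm
          (hV.norm.mul_const _) fun x => ?_
        simp only [norm_mul]
        gcongr
        exact u.norm_coe_le_norm x
    _ = (∫ x, ‖V x‖) * ‖u‖ := MeasureTheory.integral_mul_const _ _

namespace IsHeteroclinic

variable {g k p : ℝ → ℝ} {a : ℝ}

theorem hasDerivAt_comp (N : OddBistable g a) (K : IsHeteroclinic g a k p) (x : ℝ) :
    HasDerivAt (fun x => g (k x)) (deriv g (k x) * p x) x :=
  ((N.contDiff.differentiable one_ne_zero (k x)).hasDerivAt).comp x (K.hasDerivAt x)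

theorem hasDerivAt_integral_Iic (N : OddBistable g a) (K : IsHeteroclinic g a k p) (q : ℝ →ᵇ ℝ)
    (y : ℝ) : HasDerivAt (fun y => ∫ x in Set.Iic y, p x * q x) (p y * q y) y := by
  have hi := integrable_mul_boundedContinuous (K.integrable_deriv N) q
  have h : (fun y => ∫ x in Set.Iic y, p x * q x) =
      fun y => (∫ x in Set.Iic 0, p x * q x) + ∫ x in (0 : ℝ)..y, p x * q x := by
    funext z
    rw [← intervalIntegral.integral_Iic_sub_Iic hi.integrableOn hi.integrableOn]
    ring
  rw [h]
  exact ((K.continuous'.mul q.continuous).integral_hasStrictDerivAt 0 y).hasDerivAt.const_add _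

/-- On the left the integral of `p` up to `y` is `k(y) + a`, which is `O(p)`. On the right that
fails, but orthogonality replaces the integral by minus the one over `(y, ∞)`, where `p` integrates
to `a - k(y)`. -/
theorem abs_integral_Iic_le (N : OddBistable g a) (K : IsHeteroclinic g a k p) {C : ℝ}
    (h₁ : ∀ x, 0 ≤ x → a - k x ≤ C * p x) (h₂ : ∀ x, x ≤ 0 → k x + a ≤ C * p x) (q : ℝ →ᵇ ℝ)
    (hq : ∫ x, p x * q x = 0) (y : ℝ) : |∫ x in Set.Iic y, p x * q x| ≤ C * ‖q‖ * p y := by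
  have hp := K.integrable_deriv N
  have hi := integrable_mul_boundedContinuous hp q
  have key : ∀ s : Set ℝ, |∫ x in s, p x * q x| ≤ (∫ x in s, p x) * ‖q‖ := fun s => by
    rw [← MeasureTheory.integral_mul_const, ← Real.norm_eq_abs]
    refine MeasureTheory.norm_integral_le_of_norm_le (hp.integrableOn.mul_const ‖q‖)
      (Eventually.of_forall fun x => ?_)
    rw [norm_mul, Real.norm_of_nonneg (K.deriv_pos N x).le]
    exact mul_le_mul_of_nonneg_left (q.norm_coe_le_norm x) (K.deriv_pos N x).le
  rcases le_total y 0 with hy | hy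
  · refine (key _).trans ?_
    rw [MeasureTheory.integral_Iic_of_hasDerivAt_of_tendsto' (fun x _ => K.hasDerivAt x)
      hp.integrableOn K.tendsto_atBot, sub_neg_eq_add]
    calc (k y + a) * ‖q‖ ≤ (C * p y) * ‖q‖ := by gcongr; exact h₂ y hy
      _ = _ := by ring
  · have e : ∫ x in Set.Iic y, p x * q x = -∫ x in Set.Ioi y, p x * q x := by
      rw [eq_neg_iff_add_eq_zero, ← MeasureTheory.setIntegral_union (Set.Iic_disjoint_Ioi le_rfl)
        measurableSet_Ioi hi.integrableOn hi.integrableOn, Set.Iic_union_Ioi,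
        MeasureTheory.setIntegral_univ, hq]
    rw [e, abs_neg]
    refine (key _).trans ?_
    rw [MeasureTheory.integral_Ioi_of_hasDerivAt_of_tendsto' (fun x _ => K.hasDerivAt x)
      hp.integrableOn K.tendsto_atTop]
    calc (a - k y) * ‖q‖ ≤ (C * p y) * ‖q‖ := by gcongr; exact h₁ y hy
      _ = _ := by ring

/-- The linearized equation `w'' - g'(k) w = q` can be solved for `q ⟂ p` by reduction of order,
the bounded solution and its derivative depending boundedly and linearly on the right-hand side. -/
theorem exists_solution_operator (N : OddBistable g a) (K : IsHeteroclinic g a k p) :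
    ∃ S S' : (ℝ →ᵇ ℝ) →L[ℝ] (ℝ →ᵇ ℝ), ∀ h : ℝ →ᵇ ℝ, (∀ x, HasDerivAt (S h) (S' h x) x) ∧
      ∀ x, HasDerivAt (S' h) (deriv g (k x) * S h x +
        (h x - (∫ y, p y * h y) / (∫ y, p y * p y) * p x)) x := by
  obtain ⟨C, hC, hgk, hpI, h₁, h₂⟩ := K.exists_bounds N
  have hp := K.deriv_pos N
  have hpc := K.continuous'
  have hpi := K.integrable_deriv N
  obtain ⟨B, hB⟩ := exists_abs_le_of_tendsto hpc (K.deriv_tendsto_atTop N)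
    (K.deriv_tendsto_atBot N)
  set pb : ℝ →ᵇ ℝ := BoundedContinuousFunction.ofNormedAddCommGroup p hpc B hB
  have hpb : ∀ x, pb x = p x := fun x => rfl
  obtain ⟨I, hI⟩ := exists_integral_continuousLinearMap hpi
  have hpp : 0 < ∫ y, p y * p y :=
    MeasureTheory.integral_pos_of_integrable_nonneg_nonzero (x := 0) (hpc.mul hpc)
      (integrable_mul_boundedContinuous hpi pb) (fun x => (mul_pos (hp x) (hp x)).le)
      (mul_pos (hp 0) (hp 0)).ne'
  let P : (ℝ →ᵇ ℝ) →L[ℝ] (ℝ →ᵇ ℝ) :=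
    ContinuousLinearMap.id ℝ _ - ((∫ y, p y * p y)⁻¹ • I).smulRight pb
  have hP : ∀ h x, P h x = h x - (∫ y, p y * h y) / (∫ y, p y * p y) * p x := fun h x => by
    simp only [P, sub_apply, ContinuousLinearMap.id_apply,
      ContinuousLinearMap.smulRight_apply, smul_apply, hI, smul_eq_mul,
      BoundedContinuousFunction.coe_sub, BoundedContinuousFunction.coe_smul, Pi.sub_apply, hpb]
    ring
  have hP0 : ∀ h, ∫ x, p x * P h x = 0 := fun h => by
    have e : P h = h - ((∫ y, p y * p y)⁻¹ * I h) • pb := rfl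
    rw [← hI, e, map_sub, map_smul, smul_eq_mul, hI pb]
    simp only [hpb]
    rw [mul_right_comm, inv_mul_cancel₀ hpp.ne', one_mul, sub_self]
  let H : (ℝ →ᵇ ℝ) → ℝ → ℝ := fun q y => ∫ x in Set.Iic y, p x * q x
  have hHd : ∀ q y, HasDerivAt (H q) (p y * q y) y := K.hasDerivAt_integral_Iic N
  have hHc : ∀ q, Continuous (H q) := fun q =>
    continuous_iff_continuousAt.2 fun y => (hHd q y).continuousAt
  have hHP : ∀ h y, |H (P h) y| ≤ C * ‖P h‖ * p y := fun h =>
    K.abs_integral_Iic_le N h₁ h₂ (P h) (hP0 h)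
  have hHadd : ∀ q r y, H (q + r) y = H q y + H r y := fun q r y => by
    simp only [H, BoundedContinuousFunction.coe_add, Pi.add_apply, mul_add]
    exact MeasureTheory.integral_add (integrable_mul_boundedContinuous hpi q).integrableOn
      (integrable_mul_boundedContinuous hpi r).integrableOn
  have hHsmul : ∀ (c : ℝ) q y, H (c • q) y = c * H q y := fun c q y => by
    simp only [H, BoundedContinuousFunction.coe_smul, smul_eq_mul, mul_left_comm _ c]
    exact MeasureTheory.integral_const_mul _ _
  -- Substituting `w = p v` turns the equation into `(p² v')' = p q`, hence `v' = H/p²`. Since `H =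
  -- O(p)` for `q ⟂ p`, `v` is controlled by the integral of `1/p`, and `p v` is bounded.
  let v : (ℝ →ᵇ ℝ) → ℝ → ℝ := fun q x => ∫ y in (0 : ℝ)..x, H q y * ((p y)⁻¹ * (p y)⁻¹)
  have hpinv : Continuous fun y => (p y)⁻¹ := hpc.inv₀ fun y => (hp y).ne'
  have hvi : ∀ q, Continuous fun y => H q y * ((p y)⁻¹ * (p y)⁻¹) := fun q =>
    (hHc q).mul (hpinv.mul hpinv)
  have hvd : ∀ q x, HasDerivAt (v q) (H q x * ((p x)⁻¹ * (p x)⁻¹)) x := fun q x =>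
    ((hvi q).integral_hasStrictDerivAt 0 x).hasDerivAt
  have hvc : ∀ q, Continuous (v q) := fun q =>
    continuous_iff_continuousAt.2 fun y => (hvd q y).continuousAt
  have hvadd : ∀ q r x, v (q + r) x = v q x + v r x := fun q r x => by
    simp only [v, hHadd, add_mul]
    exact intervalIntegral.integral_add ((hvi q).intervalIntegrable _ _)
      ((hvi r).intervalIntegrable _ _)
  have hvsmul : ∀ (c : ℝ) q x, v (c • q) x = c * v q x := fun c q x => by
    simp only [v, hHsmul, mul_assoc]
    exact intervalIntegral.integral_const_mul _ _
  have hvP : ∀ h x, p x * |v (P h) x| ≤ C * C * ‖P h‖ := fun h x => by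
    have e : |v (P h) x| ≤ |∫ y in (0 : ℝ)..x, C * ‖P h‖ * (p y)⁻¹| := by
      rw [← Real.norm_eq_abs]
      refine intervalIntegral.norm_integral_le_abs_of_norm_le
        (Eventually.of_forall fun y => ?_) ((hpinv.const_mul _).intervalIntegrable _ _)
      have hpy := hp y
      rw [Real.norm_eq_abs, abs_mul, abs_of_pos (by positivity : 0 < (p y)⁻¹ * (p y)⁻¹)]
      calc |H (P h) y| * ((p y)⁻¹ * (p y)⁻¹) ≤ C * ‖P h‖ * p y * ((p y)⁻¹ * (p y)⁻¹) := by
            gcongr; exact hHP h y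
        _ = _ := by field_simp
    rw [intervalIntegral.integral_const_mul, abs_mul,
      abs_of_nonneg (by positivity : 0 ≤ C * ‖P h‖)] at e
    calc p x * |v (P h) x| ≤ p x * (C * ‖P h‖ * |∫ y in (0 : ℝ)..x, (p y)⁻¹|) :=
          mul_le_mul_of_nonneg_left e (hp x).le
      _ = C * ‖P h‖ * (p x * |∫ y in (0 : ℝ)..x, (p y)⁻¹|) := by ring
      _ ≤ C * ‖P h‖ * C := by gcongr; exact hpI x
      _ = _ := by ring
  have hgkc : Continuous fun x => g (k x) := N.contDiff.continuous.comp K.continuous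
  let T : (ℝ →ᵇ ℝ) →ₗ[ℝ] (ℝ → ℝ) :=
    { toFun := fun h x => p x * v (P h) x
      map_add' := fun h h' => by
        funext x; simp only [map_add, hvadd, Pi.add_apply]; ring
      map_smul' := fun c h => by
        funext x; simp only [map_smul, hvsmul, Pi.smul_apply, smul_eq_mul, RingHom.id_apply]; ring }
  -- This is `(p v)' = p' v + p v'` with `p' = g(k)` and `v' = H/p²`.
  let T' : (ℝ →ᵇ ℝ) →ₗ[ℝ] (ℝ → ℝ) :=
    { toFun := fun h x => g (k x) * v (P h) x + H (P h) x * (p x)⁻¹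
      map_add' := fun h h' => by
        funext x; simp only [map_add, hvadd, hHadd, Pi.add_apply]; ring
      map_smul' := fun c h => by
        funext x
        simp only [map_smul, hvsmul, hHsmul, Pi.smul_apply, smul_eq_mul, RingHom.id_apply]; ring }
  obtain ⟨S, hS⟩ := exists_continuousLinearMap_of_bound T (fun h => hpc.mul (hvc _))
    (C * C * ‖P‖) fun h x => by
      change |p x * v (P h) x| ≤ _
      rw [abs_mul, abs_of_pos (hp x)]
      refine (hvP h x).trans ?_
      rw [mul_assoc (C * C)]
      gcongr
      exact P.le_opNorm h
  obtain ⟨S', hS'⟩ := exists_continuousLinearMap_of_bound T'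
    (fun h => (hgkc.mul (hvc _)).add ((hHc _).mul hpinv)) ((C * (C * C) + C) * ‖P‖) fun h x => by
      change |g (k x) * v (P h) x + H (P h) x * (p x)⁻¹| ≤ _
      have hpx := hp x
      have e1 : |g (k x) * v (P h) x| ≤ C * (C * C * ‖P h‖) := by
        rw [abs_mul]
        calc |g (k x)| * |v (P h) x| ≤ (C * p x) * |v (P h) x| := by gcongr; exact hgk x
          _ = C * (p x * |v (P h) x|) := by ring
          _ ≤ _ := mul_le_mul_of_nonneg_left (hvP h x) hC.le
      have e2 : |H (P h) x * (p x)⁻¹| ≤ C * ‖P h‖ := by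
        rw [abs_mul, abs_of_pos (inv_pos.2 hpx), ← div_eq_mul_inv, div_le_iff₀ hpx]
        exact hHP h x
      calc |g (k x) * v (P h) x + H (P h) x * (p x)⁻¹|
          ≤ C * (C * C * ‖P h‖) + C * ‖P h‖ := (abs_add_le _ _).trans (add_le_add e1 e2)
        _ = (C * (C * C) + C) * ‖P h‖ := by ring
        _ ≤ (C * (C * C) + C) * (‖P‖ * ‖h‖) := by gcongr; exact P.le_opNorm h
        _ = _ := by ring
  refine ⟨S, S', fun h => ?_⟩
  have eS : ⇑(S h) = fun x => p x * v (P h) x := funext (hS h)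
  have eS' : ⇑(S' h) = fun x => g (k x) * v (P h) x + H (P h) x * (p x)⁻¹ := funext (hS' h)
  rw [eS, eS']
  refine ⟨fun x => ?_, fun x => ?_⟩
  · have hpx := (hp x).ne'
    convert! (K.hasDerivAt' x).mul (hvd (P h) x) using 1
    field_simp
  · have hpx := (hp x).ne'
    rw [← hP]
    convert! ((K.hasDerivAt_comp N x).mul (hvd (P h) x)).add
      ((hHd (P h) x).mul ((K.hasDerivAt' x).inv hpx)) using 1
    simp only [Pi.inv_apply]
    field_simp
    ring

theorem tendsto_wronskian {w w' : ℝ → ℝ}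
    {B : ℝ} (hB : ∀ x, |w x| ≤ B) (hB' : ∀ x, |w' x| ≤ B) {l : Filter ℝ}
    (h1 : Tendsto p l (𝓝 0)) (h2 : Tendsto (fun x => g (k x)) l (𝓝 0)) :
    Tendsto (fun x => p x * w' x - g (k x) * w x) l (𝓝 0) := by
  have aux : ∀ y : ℝ → ℝ, (∀ x, |y x| ≤ B) → IsBoundedUnder (· ≤ ·) l fun x => ‖y x‖ :=
    fun y hy => isBoundedUnder_of ⟨B, hy⟩
  simpa using (h1.zero_mul_isBoundedUnder_le (aux w' hB')).sub
    (h2.zero_mul_isBoundedUnder_le (aux w hB))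

theorem tendsto_comp_atTop (N : OddBistable g a) (K : IsHeteroclinic g a k p) :
    Tendsto (fun x => g (k x)) atTop (𝓝 0) := by
  have := (N.contDiff.continuous.tendsto a).comp K.tendsto_atTop
  rwa [N.zero] at this

theorem tendsto_comp_atBot (N : OddBistable g a) (K : IsHeteroclinic g a k p) :
    Tendsto (fun x => g (k x)) atBot (𝓝 0) := by
  have := (N.contDiff.continuous.tendsto (-a)).comp K.tendsto_atBot
  rwa [N.odd, N.zero, neg_zero] at this

/-- Since `p` solves the homogeneous equation, the terms with `g'(k)` cancel. For bounded `w`, `w'`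
the Wronskian vanishes at both ends, which yields both the solvability condition and the description
of the kernel. -/
theorem hasDerivAt_wronskian (N : OddBistable g a) (K : IsHeteroclinic g a k p)
    {w w' h : ℝ → ℝ} (hw : ∀ x, HasDerivAt w (w' x) x)
    (hw' : ∀ x, HasDerivAt w' (deriv g (k x) * w x + h x) x) (x : ℝ) :
    HasDerivAt (fun x => p x * w' x - g (k x) * w x) (p x * h x) x := by
  convert! ((K.hasDerivAt' x).mul (hw' x)).sub ((K.hasDerivAt_comp N x).mul (hw x)) using 1
  ring

/-- Solvability condition for the linearized equation. -/
theorem integral_eq_zero_of_linearized (N : OddBistable g a) (K : IsHeteroclinic g a k p)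
    {w w' : ℝ → ℝ} {h : ℝ →ᵇ ℝ} {B : ℝ} (hw : ∀ x, HasDerivAt w (w' x) x)
    (hw' : ∀ x, HasDerivAt w' (deriv g (k x) * w x + h x) x)
    (hB : ∀ x, |w x| ≤ B) (hB' : ∀ x, |w' x| ≤ B) : ∫ x, p x * h x = 0 := by
  rw [MeasureTheory.integral_of_hasDerivAt_of_tendsto (K.hasDerivAt_wronskian N hw hw')
    (integrable_mul_boundedContinuous (K.integrable_deriv N) h)
    (tendsto_wronskian hB hB' (K.deriv_tendsto_atBot N) (K.tendsto_comp_atBot N))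
    (tendsto_wronskian hB hB' (K.deriv_tendsto_atTop N) (K.tendsto_comp_atTop N)), sub_zero]

/-- Bounded solutions of the homogeneous linearized equation are multiples of `p`. -/
theorem exists_eq_mul_of_linearized (N : OddBistable g a) (K : IsHeteroclinic g a k p)
    {w w' : ℝ → ℝ} {B : ℝ} (hw : ∀ x, HasDerivAt w (w' x) x)
    (hw' : ∀ x, HasDerivAt w' (deriv g (k x) * w x) x)
    (hB : ∀ x, |w x| ≤ B) (hB' : ∀ x, |w' x| ≤ B) :
    ∃ t : ℝ, ∀ x, w x = t * p x ∧ w' x = t * g (k x) := by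
  have hp := K.deriv_pos N
  have hd := K.hasDerivAt_wronskian N (h := fun _ => 0) hw (by simpa using hw')
  simp only [mul_zero] at hd
  have hconst := is_const_of_deriv_eq_zero (fun x => (hd x).differentiableAt) fun x => (hd x).deriv
  have hlim := tendsto_wronskian hB hB' (K.deriv_tendsto_atTop N) (K.tendsto_comp_atTop N)
  have hW : ∀ x, p x * w' x - g (k x) * w x = 0 := fun x => by
    have : (fun y => p y * w' y - g (k y) * w y) = fun _ => p x * w' x - g (k x) * w x :=
      funext fun y => hconst y x
    rw [this] at hlim
    exact tendsto_nhds_unique tendsto_const_nhds hlim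
  have hq : ∀ x, HasDerivAt (fun x => w x / p x) 0 x := fun x => by
    convert! (hw x).div (K.hasDerivAt' x) (hp x).ne' using 1
    rw [eq_comm, div_eq_zero_iff]; left; linarith [hW x]
  have hqc := is_const_of_deriv_eq_zero (fun x => (hq x).differentiableAt) fun x => (hq x).deriv
  have h1 : ∀ x, w x = w 0 / p 0 * p x := fun x => by
    have := hqc x 0
    rw [← this, div_mul_cancel₀ _ (hp x).ne']
  refine ⟨w 0 / p 0, fun x => ⟨h1 x, ?_⟩⟩
  have := hW x
  rw [h1 x] at this
  have h2 : p x * (w' x - w 0 / p 0 * g (k x)) = 0 := by linarith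
  have := (mul_eq_zero.1 h2).resolve_left (hp x).ne'
  linarith

end IsHeteroclinic

/-! ### Superposition operators and the implicit function theorem -/

/-- The superposition operator `w ↦ g ∘ w` on bounded continuous functions. -/
noncomputable def superposition (g : ℝ → ℝ) (hg : Continuous g) (w : ℝ →ᵇ ℝ) : ℝ →ᵇ ℝ :=
  have h : ∃ B, ∀ x, |g (w x)| ≤ B := by
    obtain ⟨B, hB⟩ := (isCompact_Icc (a := -‖w‖) (b := ‖w‖)).exists_bound_of_continuousOn
      hg.continuousOn
    exact ⟨B, fun x => hB _ (abs_le.1 (w.norm_coe_le_norm x))⟩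
  BoundedContinuousFunction.ofNormedAddCommGroup (fun x => g (w x)) (hg.comp w.continuous)
    h.choose h.choose_spec

@[simp] theorem superposition_apply (g : ℝ → ℝ) (hg : Continuous g) (w : ℝ →ᵇ ℝ) (x : ℝ) :
    superposition g hg w x = g (w x) := rfl

/-- Pointwise, the Taylor remainder has derivative `g'(k + s) - g'(k)` in `s`. Uniform continuity of
`g'` on a compact interval makes this small uniformly in `x`, and the mean value inequality gives
strict differentiability in the sup norm. -/
theorem hasStrictFDerivAt_superposition_sub {g : ℝ → ℝ} (hg : ContDiff ℝ 1 g) (k : ℝ →ᵇ ℝ) :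
    HasStrictFDerivAt (fun w => superposition g hg.continuous (k + w) -
      superposition g hg.continuous k -
      superposition (deriv g) (hg.continuous_deriv le_rfl) k * w) (0 : (ℝ →ᵇ ℝ) →L[ℝ] ℝ →ᵇ ℝ) 0 := by
  refine .of_isLittleO (Asymptotics.isLittleO_iff.2 fun c hc => ?_)
  have huc := (isCompact_Icc (a := -(‖k‖ + 1)) (b := ‖k‖ + 1)).uniformContinuousOn_of_continuous
    (hg.continuous_deriv le_rfl).continuousOn
  obtain ⟨δ, hδ, h⟩ := Metric.uniformContinuousOn_iff.1 huc c hc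
  have hr : 0 < min δ 1 := lt_min hδ one_pos
  have hnear : ∀ᶠ q : (ℝ →ᵇ ℝ) × (ℝ →ᵇ ℝ) in 𝓝 (0, 0), ‖q.1‖ < min δ 1 ∧ ‖q.2‖ < min δ 1 := by
    filter_upwards [Metric.ball_mem_nhds (0, 0) hr] with q hq
    rw [Metric.mem_ball, Prod.dist_eq, max_lt_iff] at hq
    simpa using hq
  filter_upwards [hnear] with q hq
  refine (BoundedContinuousFunction.norm_le (by positivity)).2 fun x => ?_
  have hkx : |k x| ≤ ‖k‖ := k.norm_coe_le_norm x
  have hd : ∀ s : ℝ, HasDerivAt (fun s => g (k x + s) - deriv g (k x) * s)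
      (deriv g (k x + s) - deriv g (k x)) s := fun s => by
    have h1 := ((hg.differentiable one_ne_zero (k x + s)).hasDerivAt).comp_const_add (k x) s
    convert! h1.sub ((hasDerivAt_id s).const_mul (deriv g (k x))) using 1
    rw [mul_one]
  have hb : ∀ s ∈ Metric.ball (0 : ℝ) (min δ 1), ‖deriv g (k x + s) - deriv g (k x)‖ ≤ c := by
    intro s hs
    rw [mem_ball_zero_iff, Real.norm_eq_abs, lt_min_iff] at hs
    refine (h _ ?_ _ ?_ ?_).le
    · rw [Set.mem_Icc, ← abs_le]
      exact (abs_add_le _ _).trans (by linarith)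
    · rw [Set.mem_Icc, ← abs_le]; linarith
    · rw [Real.dist_eq, add_sub_cancel_left]; exact hs.1
  have hq1 := (q.1.norm_coe_le_norm x).trans_lt hq.1
  have hq2 := (q.2.norm_coe_le_norm x).trans_lt hq.2
  have hmv := (convex_ball (0 : ℝ) (min δ 1)).norm_image_sub_le_of_norm_hasDerivWithin_le
    (fun s _ => (hd s).hasDerivWithinAt) hb (mem_ball_zero_iff.2 hq2) (mem_ball_zero_iff.2 hq1)
  refine le_trans (le_of_eq ?_) (hmv.trans ?_)
  · congr 1
    simp
    ring
  · gcongr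
    exact (q.1 - q.2).norm_coe_le_norm x

/-- A quantitative form of the implicit function theorem with a real parameter. -/
theorem exists_implicit_branch {E F : Type*} [NormedAddCommGroup E] [NormedSpace ℝ E]
    [CompleteSpace E] [NormedAddCommGroup F] [NormedSpace ℝ F] [CompleteSpace F]
    {Φ : ℝ × E → F} {Φ' : ℝ × E →L[ℝ] F} (hΦ : HasStrictFDerivAt Φ Φ' 0) (h0 : Φ 0 = 0)
    (hinv : (Φ' ∘L .inr ℝ ℝ E).IsInvertible) :
    ∃ ε₀ > 0, ∃ ρ > 0, ∃ L > 0, ∃ ψ : ℝ → E, ψ 0 = 0 ∧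
      (∀ ε, |ε| < ε₀ → Φ (ε, ψ ε) = 0) ∧
      (∀ ε ε', |ε| < ε₀ → |ε'| < ε₀ → ‖ψ ε - ψ ε'‖ ≤ L * |ε - ε'|) ∧
      ∀ ε z, |ε| < ε₀ → ‖z‖ < ρ → Φ (ε, z) = 0 → z = ψ ε := by
  have h1 := hΦ.eventually_apply_eq_iff_implicitFunctionOfProdDomain hinv
  have h2 := hΦ.eventually_apply_implicitFunctionOfProdDomain hinv
  obtain ⟨L, s, hs, hL⟩ :=
    (hΦ.hasStrictFDerivAt_implicitFunctionOfProdDomain hinv).exists_lipschitzOnWith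
  set ψ := hΦ.implicitFunctionOfProdDomain hinv
  simp only [h0, Prod.fst_zero] at h1 h2 hs
  obtain ⟨r, hr, h1⟩ := Metric.eventually_nhds_iff_ball.1 h1
  obtain ⟨r', hr', h2⟩ := Metric.eventually_nhds_iff_ball.1 h2
  obtain ⟨r'', hr'', h3⟩ := Metric.mem_nhds_iff.1 hs
  have hmem : ∀ {ε : ℝ}, |ε| < min r (min r' r'') → ε ∈ Metric.ball 0 r ∧ ε ∈ Metric.ball 0 r' ∧
      ε ∈ Metric.ball 0 r'' := fun {ε} hε => by
    simpa only [mem_ball_zero_iff, lt_min_iff, Real.norm_eq_abs] using hε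
  -- The Lipschitz constant `L` may be zero and a positive one is required, hence `L + 1`.
  refine ⟨min r (min r' r''), by positivity, r, hr, L + 1, by positivity, ψ, ?_,
    fun ε hε => h2 ε (hmem hε).2.1, fun ε ε' hε hε' => ?_, fun ε z hε hz h => ?_⟩
  · exact (h1 0 (Metric.mem_ball_self hr)).1 h0
  · have := hL.dist_le_mul ε (h3 (hmem hε).2.2) ε' (h3 (hmem hε').2.2)
    rw [dist_eq_norm, Real.dist_eq] at this
    exact this.trans (by gcongr; linarith)
  · refine ((h1 (ε, z) ?_).1 h).symm
    rw [mem_ball_zero_iff, Prod.norm_def, max_lt_iff]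
    exact ⟨(lt_min_iff.1 hε).1, hz⟩

/-- The shape of the linearized bordered problem: the differential equation contributes the identity
block, so invertibility rests on the single number `m`, here `-M''(s₀)/2`. -/
theorem isInvertible_of_triangular {E : Type*} [NormedAddCommGroup E] [NormedSpace ℝ E]
    {A : E × ℝ →L[ℝ] E × ℝ} {l : E →L[ℝ] ℝ} {m : ℝ} (hm : m ≠ 0)
    (hA : ∀ z, A z = (z.1, l z.1 + z.2 * m)) : A.IsInvertible := by
  let B : E × ℝ →L[ℝ] E × ℝ := (ContinuousLinearMap.fst ℝ E ℝ).prod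
    (m⁻¹ • (ContinuousLinearMap.snd ℝ E ℝ - l ∘L ContinuousLinearMap.fst ℝ E ℝ))
  refine ⟨ContinuousLinearEquiv.equivOfInverse A B (fun z => ?_) fun z => ?_, rfl⟩
  · rw [hA]
    ext <;> simp [B]
    field_simp
  · rw [hA]
    ext <;> simp [B]
    field_simp
    ring

/-! ### The branch of the bordered problem -/

namespace IsHeteroclinic

variable {g k p V : ℝ → ℝ} {a : ℝ}

/-- The branch of solutions of the bordered problem
`w'' = g (k + w) - g k + 2 ε V (k + w) - c p`, `∫ V (k + w) (k + w)' = 0`. -/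
theorem exists_branch (N : OddBistable g a) (K : IsHeteroclinic g a k p) (hVc : Continuous V)
    (hVi : MeasureTheory.Integrable V) {B : ℝ} (hVB : ∀ x, |V x| ≤ B)
    (h0 : ∫ x, V x * (k x * p x) = 0) (h1 : ∫ x, V x * (p x * p x + k x * g (k x)) ≠ 0) :
    ∃ ε₀ > 0, ∃ ρ > 0, ∃ L > 0, ∃ w w' : ℝ → ℝ →ᵇ ℝ,
      (∀ ε, |ε| < ε₀ → (∀ x, HasDerivAt (w ε) (w' ε x) x) ∧
        (∃ c : ℝ, ∀ x, HasDerivAt (w' ε)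
          (g (k x + w ε x) - g (k x) + 2 * ε * (V x * (k x + w ε x)) - c * p x) x) ∧
        (∫ x, V x * ((k x + w ε x) * (p x + w' ε x)) = 0) ∧
        ‖w ε‖ ≤ L * |ε| ∧ ‖w' ε‖ ≤ L * |ε|) ∧
      (∀ ε ε', |ε| < ε₀ → |ε'| < ε₀ → ‖w ε - w ε'‖ ≤ L * |ε - ε'|) ∧
      ∀ (ε : ℝ) (u u' : ℝ →ᵇ ℝ), |ε| < ε₀ → ‖u‖ < ρ → (∀ x, HasDerivAt u (u' x) x) →
        (∀ x, HasDerivAt u' (g (k x + u x) - g (k x) + 2 * ε * (V x * (k x + u x))) x) →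
        ∫ x, V x * ((k x + u x) * (p x + u' x)) = 0 → u = w ε := by
  obtain ⟨S, S', hS⟩ := K.exists_solution_operator N
  obtain ⟨I, hI⟩ := exists_integral_continuousLinearMap hVi
  obtain ⟨Bk, hBk⟩ := K.exists_bound
  obtain ⟨Bp, hBp⟩ := exists_abs_le_of_tendsto K.continuous' (K.deriv_tendsto_atTop N)
    (K.deriv_tendsto_atBot N)
  have hp := K.deriv_pos N
  let kb : ℝ →ᵇ ℝ := .ofNormedAddCommGroup k K.continuous Bk hBk
  let pb : ℝ →ᵇ ℝ := .ofNormedAddCommGroup p K.continuous' Bp hBp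
  let Vb : ℝ →ᵇ ℝ := .ofNormedAddCommGroup V hVc B hVB
  let gb : ℝ →ᵇ ℝ := superposition g N.contDiff.continuous kb
  have ek : ∀ x, kb x = k x := fun _ => rfl
  have ep : ∀ x, pb x = p x := fun _ => rfl
  have eg : ∀ x, gb x = g (k x) := fun _ => rfl
  -- The equation becomes `w'' - g'(k)w = R(ε, w)` up to the multiplier. The derivative of `R` at
  -- the origin has no `w`-component.
  let R : ℝ × (ℝ →ᵇ ℝ) → ℝ →ᵇ ℝ := fun q =>
    (superposition g N.contDiff.continuous (kb + q.2) - superposition g N.contDiff.continuous kb -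
      superposition (deriv g) (N.contDiff.continuous_deriv le_rfl) kb * q.2) +
      (2 * q.1) • (Vb * (kb + q.2))
  have eR : ∀ ε u x, R (ε, u) x = g (k x + u x) - g (k x) - deriv g (k x) * u x +
      2 * ε * (V x * (k x + u x)) := fun ε u x => rfl
  have hR0 : R 0 = 0 := by
    ext x
    change R (0, 0) x = 0
    simp [eR]
  have hR : HasStrictFDerivAt R
      (((2 : ℝ) • ContinuousLinearMap.fst ℝ ℝ (ℝ →ᵇ ℝ)).smulRight (Vb * kb)) 0 := by
    have e1 := HasStrictFDerivAt.comp (0 : ℝ × (ℝ →ᵇ ℝ)) (f := Prod.snd)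
      (hasStrictFDerivAt_superposition_sub N.contDiff kb) hasStrictFDerivAt_snd
    have e2 : HasStrictFDerivAt (fun q : ℝ × (ℝ →ᵇ ℝ) => 2 * q.1)
        ((2 : ℝ) • ContinuousLinearMap.fst ℝ ℝ (ℝ →ᵇ ℝ)) 0 := hasStrictFDerivAt_fst.const_mul 2
    have e3 : HasStrictFDerivAt (fun q : ℝ × (ℝ →ᵇ ℝ) => Vb * (kb + q.2))
        ((ContinuousLinearMap.mul ℝ _ Vb) ∘L ContinuousLinearMap.snd ℝ ℝ (ℝ →ᵇ ℝ)) 0 :=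
      (ContinuousLinearMap.mul ℝ (ℝ →ᵇ ℝ) Vb).hasStrictFDerivAt.comp _
        (hasStrictFDerivAt_snd.const_add kb)
    exact (e1.add (e2.smul e3)).congr_fderiv (ContinuousLinearMap.ext fun q => by simp)
  -- The unknown is the pair `(h, t)`, with `w = S h + t p` and `w' = S' h + t g(k)`. These
  -- coordinates avoid a space of differentiable functions.
  let W : (ℝ →ᵇ ℝ) × ℝ →L[ℝ] ℝ →ᵇ ℝ :=
    S ∘L ContinuousLinearMap.fst ℝ _ ℝ + (ContinuousLinearMap.snd ℝ _ ℝ).smulRight pb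
  let W' : (ℝ →ᵇ ℝ) × ℝ →L[ℝ] ℝ →ᵇ ℝ :=
    S' ∘L ContinuousLinearMap.fst ℝ _ ℝ + (ContinuousLinearMap.snd ℝ _ ℝ).smulRight gb
  have eW : ∀ z x, W z x = S z.1 x + z.2 * p x := fun z x => rfl
  have eW' : ∀ z x, W' z x = S' z.1 x + z.2 * g (k x) := fun z x => rfl
  have hWd : ∀ z x, HasDerivAt (W z) (W' z x) x := fun z x =>
    ((hS z.1).1 x).add ((K.hasDerivAt' x).const_mul z.2)
  have hWd' : ∀ z x, HasDerivAt (W' z) (deriv g (k x) * W z x +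
      (z.1 x - (∫ y, p y * z.1 y) / (∫ y, p y * p y) * p x)) x := fun z x => by
    convert! ((hS z.1).2 x).add ((K.hasDerivAt_comp N x).const_mul z.2) using 1
    rw [eW]; ring
  let Q : (ℝ →ᵇ ℝ) × ℝ → ℝ := fun z => I ((kb + W z) * (pb + W' z))
  have eQ : ∀ z, Q z = ∫ x, V x * ((k x + W z x) * (p x + W' z x)) := fun z => hI _
  have hQ : HasStrictFDerivAt Q (I ∘L ((ContinuousLinearMap.mul ℝ _ kb) ∘L W' +
      (ContinuousLinearMap.mul ℝ _ pb) ∘L W)) 0 := by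
    refine I.hasStrictFDerivAt.comp _ ?_
    exact ((W.hasStrictFDerivAt.const_add kb).mul (W'.hasStrictFDerivAt.const_add pb)).congr_fderiv
      (ContinuousLinearMap.ext fun z => by simp)
  -- The first component states that `h` is the right-hand side generated by `W(h, t)`; the second
  -- is the Melnikov condition, already freed of its factor `ε`.
  let Φ : ℝ × ((ℝ →ᵇ ℝ) × ℝ) → (ℝ →ᵇ ℝ) × ℝ := fun q => (q.2.1 - R (q.1, W q.2), Q q.2)
  have hΦ0 : Φ 0 = 0 := by
    refine Prod.ext ?_ ?_
    · change (0 : ℝ →ᵇ ℝ) - R (0, W 0) = 0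
      rw [map_zero, show ((0 : ℝ), (0 : ℝ →ᵇ ℝ)) = 0 from rfl, hR0, sub_zero]
    · change Q 0 = 0
      rw [eQ]
      simpa using h0
  have hq : HasStrictFDerivAt (fun q : ℝ × ((ℝ →ᵇ ℝ) × ℝ) => (q.1, W q.2))
      ((ContinuousLinearMap.fst ℝ ℝ _).prod (W ∘L ContinuousLinearMap.snd ℝ ℝ _)) 0 :=
    ContinuousLinearMap.hasStrictFDerivAt
      ((ContinuousLinearMap.fst ℝ ℝ ((ℝ →ᵇ ℝ) × ℝ)).prod (W ∘L ContinuousLinearMap.snd ℝ ℝ _))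
  have hR' : HasStrictFDerivAt R
      (((2 : ℝ) • ContinuousLinearMap.fst ℝ ℝ (ℝ →ᵇ ℝ)).smulRight (Vb * kb)) (0, W 0) := by
    rw [map_zero]; exact hR
  have hRq := HasStrictFDerivAt.comp (0 : ℝ × ((ℝ →ᵇ ℝ) × ℝ)) (g := R) hR' hq
  have hΦ : HasStrictFDerivAt Φ _ 0 :=
    ((hasStrictFDerivAt_snd (𝕜 := ℝ) (p := (0 : ℝ × ((ℝ →ᵇ ℝ) × ℝ)))).fst.sub hRq).prodMk
    (HasStrictFDerivAt.comp (0 : ℝ × ((ℝ →ᵇ ℝ) × ℝ)) (f := Prod.snd) hQ hasStrictFDerivAt_snd)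
  have hm : I (kb * gb + pb * pb) ≠ 0 := by
    rw [hI]
    convert! h1 using 3 with x
    change V x * (k x * g (k x) + p x * p x) = _
    ring
  obtain ⟨ε₀, hε₀, ρ, hρ, L, hL, ψ, hψ0, hψ, hψL, hψu⟩ := exists_implicit_branch hΦ hΦ0
    (isInvertible_of_triangular (m := I (kb * gb + pb * pb))
      (l := I ∘L ((ContinuousLinearMap.mul ℝ _ kb) ∘L S' + (ContinuousLinearMap.mul ℝ _ pb) ∘L S))
      hm fun z => by
        have hz : ∀ z : (ℝ →ᵇ ℝ) × ℝ, kb * W' z + pb * W z =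
            (kb * S' z.1 + pb * S z.1) + z.2 • (kb * gb + pb * pb) := fun z => by
          ext x
          simp only [BoundedContinuousFunction.coe_add, BoundedContinuousFunction.coe_mul,
            Pi.add_apply, Pi.mul_apply, BoundedContinuousFunction.coe_smul, smul_eq_mul, eW, eW',
            ek, ep, eg]
          ring
        refine Prod.ext (by simp) ?_
        change I (kb * W' z + pb * W z) = I (kb * S' z.1 + pb * S z.1) + _
        rw [hz, map_add, map_smul, smul_eq_mul])
  -- Uniqueness is claimed for `u` small in the sup norm only. Its coordinates are `h = R(ε, u)` and
  -- `t`, found by evaluating `u = S h + t p` at `0`. They depend continuously on `(ε, u)`, so they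
  -- are small too.
  have hsmall : ∀ᶠ q : ℝ × (ℝ →ᵇ ℝ) in 𝓝 0, ‖(R q, (q.2 0 - S (R q) 0) / p 0)‖ < ρ := by
    have hRc : ContinuousAt R 0 := hR.continuousAt
    have he : ∀ x : ℝ, Continuous fun u : ℝ →ᵇ ℝ => u x := fun x => continuous_eval_const x
    have hc : ContinuousAt (fun q : ℝ × (ℝ →ᵇ ℝ) => ‖(R q, (q.2 0 - S (R q) 0) / p 0)‖) 0 := by
      refine (hRc.prodMk (ContinuousAt.div_const (ContinuousAt.sub ?_ ?_) _)).norm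
      · exact ((he 0).comp continuous_snd).continuousAt
      · exact ((he 0).comp S.continuous).continuousAt.comp hRc
    refine hc.eventually (gt_mem_nhds ?_)
    simpa [hR0] using hρ
  obtain ⟨r, hr, hsmall⟩ := Metric.eventually_nhds_iff_ball.1 hsmall
  have hψn : ∀ ε, |ε| < ε₀ → ‖ψ ε‖ ≤ L * |ε| := fun ε hε => by
    simpa [hψ0] using hψL ε 0 hε (by simpa using hε₀)
  have hW1 : ∀ ε, |ε| < ε₀ → ‖W (ψ ε)‖ ≤ ((‖W‖ + ‖W'‖) * L + 1) * |ε| := fun ε hε => by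
    have := mul_le_mul_of_nonneg_left (hψn ε hε) (norm_nonneg W)
    have h2 := W.le_opNorm (ψ ε)
    have h3 : 0 ≤ ‖W'‖ * L * |ε| := by positivity
    nlinarith [abs_nonneg ε]
  have hW2 : ∀ ε, |ε| < ε₀ → ‖W' (ψ ε)‖ ≤ ((‖W‖ + ‖W'‖) * L + 1) * |ε| := fun ε hε => by
    have := mul_le_mul_of_nonneg_left (hψn ε hε) (norm_nonneg W')
    have h2 := W'.le_opNorm (ψ ε)
    have h3 : 0 ≤ ‖W‖ * L * |ε| := by positivity
    nlinarith [abs_nonneg ε]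
  refine ⟨min ε₀ r, lt_min hε₀ hr, r, hr, (‖W‖ + ‖W'‖) * L + 1, by positivity,
    fun ε => W (ψ ε), fun ε => W' (ψ ε), fun ε hε => ?_, fun ε ε' hε hε' => ?_,
    fun ε u u' hε hu hud hud' hint => ?_⟩
  · have hε1 := (lt_min_iff.1 hε).1
    have h3 := hψ ε hε1
    have h4 : (ψ ε).1 = R (ε, W (ψ ε)) := sub_eq_zero.1 (congrArg Prod.fst h3)
    refine ⟨hWd _, ⟨(∫ y, p y * (ψ ε).1 y) / (∫ y, p y * p y), fun x => ?_⟩, ?_, hW1 ε hε1,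
      hW2 ε hε1⟩
    · convert! hWd' (ψ ε) x using 1
      have h5 := congrArg (fun u : ℝ →ᵇ ℝ => u x) h4
      simp only [eR] at h5
      rw [h5]
      ring
    · rw [← eQ]
      exact congrArg Prod.snd h3
  · have h3 := hψL ε ε' (lt_min_iff.1 hε).1 (lt_min_iff.1 hε').1
    have h4 := W.le_opNorm (ψ ε - ψ ε')
    rw [map_sub] at h4
    have h5 := mul_le_mul_of_nonneg_left h3 (norm_nonneg W)
    have h6 : 0 ≤ ‖W'‖ * L * |ε - ε'| := by positivity
    nlinarith [abs_nonneg (ε - ε')]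
  · have hs := hsmall (ε, u) (by
      rw [mem_ball_zero_iff, Prod.norm_def, max_lt_iff]
      exact ⟨(lt_min_iff.1 hε).2, hu⟩)
    have hlin : ∀ x, HasDerivAt u' (deriv g (k x) * u x + R (ε, u) x) x := fun x => by
      convert! hud' x using 1
      rw [eR]; ring
    -- The equation for `u` has no multiplier, so `R(ε, u)` satisfies the solvability condition and
    -- the projection in `S` does nothing. Then `u - S R(ε, u)` is a bounded homogeneous solution,
    -- that is, `t p`.
    have horth := K.integral_eq_zero_of_linearized N (B := max ‖u‖ ‖u'‖) hud hlin
      (fun x => (u.norm_coe_le_norm x).trans (le_max_left _ _))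
      (fun x => (u'.norm_coe_le_norm x).trans (le_max_right _ _))
    obtain ⟨hSd, hSd'⟩ := hS (R (ε, u))
    rw [horth] at hSd'
    obtain ⟨t, ht⟩ := K.exists_eq_mul_of_linearized N (w := fun x => u x - S (R (ε, u)) x)
      (w' := fun x => u' x - S' (R (ε, u)) x)
      (B := max ‖u - S (R (ε, u))‖ ‖u' - S' (R (ε, u))‖) (fun x => (hud x).sub (hSd x))
      (fun x => by
        convert! (hlin x).sub (hSd' x) using 1
        ring)
      (fun x => ((u - S (R (ε, u))).norm_coe_le_norm x).trans (le_max_left _ _))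
      (fun x => ((u' - S' (R (ε, u))).norm_coe_le_norm x).trans (le_max_right _ _))
    have ht0 : t = (u 0 - S (R (ε, u)) 0) / p 0 := by
      rw [eq_div_iff (hp 0).ne']; exact (ht 0).1.symm
    have hWu : W (R (ε, u), t) = u := by
      ext x
      have := (ht x).1
      rw [eW]
      linarith
    have hWu' : W' (R (ε, u), t) = u' := by
      ext x
      have := (ht x).2
      rw [eW']
      linarith
    change u = W (ψ ε)
    rw [← hψu ε (R (ε, u), t) (lt_min_iff.1 hε).1 (by rw [ht0]; exact hs) ?_]
    · exact hWu.symm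
    · refine Prod.ext ?_ ?_
      · change R (ε, u) - R (ε, W (R (ε, u), t)) = 0
        rw [hWu, sub_self]
      · change Q _ = 0
        rw [eQ, hWu, hWu']
        exact hint

end IsHeteroclinic

/-! ### From standing waves to the stationary equation -/

/-- The nonlinearity of the stationary equation `φ'' = 2 (f(φ²) - f(q₀)) φ + 2 ε V φ`. -/
def stationaryNonlinearity (f : ℝ → ℝ) (q₀ u : ℝ) : ℝ := 2 * (f (u ^ 2) - f q₀) * u

/-- Only `f` on `[0, ∞)` enters, through `u²`. Nondegeneracy comes from `g'(√q₀) = 4 q₀ f'(q₀)`. -/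
theorem oddBistable_stationaryNonlinearity {f : ℝ → ℝ} {q₀ : ℝ}
    (hf : ContDiffOn ℝ 1 f (Set.Ici 0)) (hq₀ : 0 < q₀) (hf' : 0 < deriv f q₀) :
    OddBistable (stationaryNonlinearity f q₀) (√q₀) where
  contDiff := by
    have h1 : ContDiff ℝ 1 fun u : ℝ => f (u ^ 2) := by
      rw [← contDiffOn_univ]
      exact hf.comp (contDiff_id.pow 2).contDiffOn fun u _ => sq_nonneg u
    exact (contDiff_const.mul (h1.sub contDiff_const)).mul contDiff_id
  odd u := by simp [stationaryNonlinearity]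
  pos := Real.sqrt_pos.2 hq₀
  zero := by simp [stationaryNonlinearity, Real.sq_sqrt hq₀.le]
  deriv_pos := by
    have h1 : HasDerivAt f (deriv f q₀) (√q₀ ^ 2) := by
      rw [Real.sq_sqrt hq₀.le]
      exact (differentiableAt_of_deriv_ne_zero hf'.ne').hasDerivAt
    have h2 : HasDerivAt (fun u : ℝ => f (u ^ 2)) (deriv f q₀ * (2 * √q₀)) (√q₀) := by
      exact HasDerivAt.comp (h := fun u : ℝ => u ^ 2) (√q₀) h1
        (by simpa using hasDerivAt_pow 2 (√q₀))
    have h3 : HasDerivAt (stationaryNonlinearity f q₀) _ (√q₀) :=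
      ((h2.sub_const (f q₀)).const_mul 2).mul (hasDerivAt_id (√q₀))
    rw [h3.deriv]
    have := Real.sqrt_pos.2 hq₀
    simp only [mul_one, Real.sq_sqrt hq₀.le, sub_self, mul_zero, add_zero]
    positivity

theorem convergesExponentially_iff {q₀ : ℝ} {φ : ℝ → ℝ} : ConvergesExponentially q₀ φ ↔
    RightDecay (fun x => φ x - √q₀) ∧ RightDecay fun x => φ (-x) + √q₀ := by
  constructor
  · rintro ⟨C, hC, κ, hκ, h⟩
    have ha := Real.sqrt_nonneg q₀
    have hb : ∀ x, 0 ≤ x → C * Real.exp (-κ * x) ≤ C := fun x hx =>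
      mul_le_of_le_one_right hC.le (Real.exp_le_one_iff.2 (by nlinarith))
    have hφ : ∀ x, |φ x| ≤ C + √q₀ := fun x => by
      rcases le_total 0 x with hx | hx
      · have h1 := (h x hx).1.trans (hb x hx)
        rw [abs_le] at h1 ⊢
        constructor <;> linarith
      · have h1 := (h (-x) (by linarith)).2.trans (hb (-x) (by linarith))
        rw [neg_neg, abs_le] at h1
        rw [abs_le]
        constructor <;> linarith
    refine ⟨RightDecay.of_eventually (B := C + √q₀ + √q₀) (X := 0) hκ (fun x => ?_)
      fun x hx => (h x hx).1, RightDecay.of_eventually (B := C + √q₀ + √q₀) (X := 0) hκ (fun x => ?_)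
      fun x hx => (h x hx).2⟩
    · refine (abs_sub _ _).trans ?_
      rw [abs_of_nonneg ha]; gcongr; exact hφ x
    · refine (abs_add_le _ _).trans ?_
      rw [abs_of_nonneg ha]; gcongr; exact hφ _
  · rintro ⟨⟨C, κ, hκ, h⟩, ⟨C', κ', hκ', h'⟩⟩
    refine ⟨|C| + |C'| + 1, by positivity, min κ κ', lt_min hκ hκ', fun x hx => ?_⟩
    have aux : ∀ c ν : ℝ, |c| ≤ |C| + |C'| + 1 → min κ κ' ≤ ν →
        c * Real.exp (-ν * x) ≤ (|C| + |C'| + 1) * Real.exp (-(min κ κ') * x) := fun c ν hc hν => by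
      have : Real.exp (-ν * x) ≤ Real.exp (-(min κ κ') * x) :=
        Real.exp_le_exp.2 (by nlinarith)
      calc c * Real.exp (-ν * x) ≤ |c| * Real.exp (-ν * x) := by gcongr; exact le_abs_self c
        _ ≤ _ := by gcongr
    exact ⟨(h x).trans (aux C κ (by linarith [abs_nonneg C']) (min_le_left _ _)),
      (h' x).trans (aux C' κ' (by linarith [abs_nonneg C]) (min_le_right _ _))⟩

theorem iteratedDeriv_two_of_hasDerivAt {E : Type*} [NormedAddCommGroup E] [NormedSpace ℝ E]
    {u u' u'' : ℝ → E} (hu : ∀ x, HasDerivAt u (u' x) x) (hu' : ∀ x, HasDerivAt u' (u'' x) x)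
    (x : ℝ) : iteratedDeriv 2 u x = u'' x := by
  rw [iteratedDeriv_succ, iteratedDeriv_one, funext fun y => (hu y).deriv, (hu' x).deriv]

theorem norm_standingWave (φ : ℝ → ℝ) (ω θ x t : ℝ) : ‖standingWave φ ω θ x t‖ = |φ x| := by
  have h : -Complex.I * ω * t + Complex.I * θ = ((-(ω * t) + θ : ℝ) : ℂ) * Complex.I := by
    push_cast; ring
  rw [standingWave, norm_mul, h, Complex.norm_exp_ofReal_mul_I, mul_one, Complex.norm_real,
    Real.norm_eq_abs]

theorem hasDerivAt_standingWave_time (φ : ℝ → ℝ) (ω θ x t : ℝ) :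
    HasDerivAt (fun τ : ℝ => standingWave φ ω θ x τ)
      (-Complex.I * ω * standingWave φ ω θ x t) t := by
  have h1 : HasDerivAt (fun τ : ℝ => -Complex.I * ω * (τ : ℂ) + Complex.I * θ)
      (-Complex.I * ω) t := by
    simpa using ((Complex.ofRealCLM.hasDerivAt (x := t)).const_mul (-Complex.I * ω)).add_const
      (Complex.I * θ)
  convert! (h1.cexp).const_mul (φ x : ℂ) using 1
  rw [standingWave]; ring

/-- A standing wave solves the Gross–Pitaevskii equation at a point if and only if its profile
solves the stationary equation there. -/
theorem standingWave_equation_iff {f V φ φ' φ'' : ℝ → ℝ} {q₀ ε : ℝ}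
    (hφ : ∀ x, HasDerivAt φ (φ' x) x) (hφ' : ∀ x, HasDerivAt φ' (φ'' x) x) (θ x t : ℝ) :
    (Complex.I * deriv (fun τ => standingWave φ (f q₀) θ x τ) t =
      -(1 / 2) * iteratedDeriv 2 (fun y => standingWave φ (f q₀) θ y t) x
        + (f (‖standingWave φ (f q₀) θ x t‖ ^ 2) : ℂ) * standingWave φ (f q₀) θ x t
        + ((ε * V x : ℝ) : ℂ) * standingWave φ (f q₀) θ x t) ↔
    φ'' x = stationaryNonlinearity f q₀ (φ x) + 2 * ε * (V x * φ x) := by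
  set e := Complex.exp (-Complex.I * (f q₀) * t + Complex.I * θ) with he
  have he0 : e ≠ 0 := Complex.exp_ne_zero _
  have hs : standingWave φ (f q₀) θ x t = φ x * e := rfl
  have h2 : iteratedDeriv 2 (fun y => standingWave φ (f q₀) θ y t) x = φ'' x * e :=
    iteratedDeriv_two_of_hasDerivAt (u := fun y => standingWave φ (f q₀) θ y t)
      (u' := fun y => φ' y * e) (u'' := fun y => φ'' y * e)
      (fun y => (hφ y).ofReal_comp.mul_const e) (fun y => (hφ' y).ofReal_comp.mul_const e) x
  rw [(hasDerivAt_standingWave_time φ (f q₀) θ x t).deriv, h2, norm_standingWave, sq_abs, hs,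
    stationaryNonlinearity]
  have e1 : Complex.I * (-Complex.I * (f q₀ : ℂ) * (φ x * e)) = ((f q₀ * φ x : ℝ) : ℂ) * e := by
    push_cast
    linear_combination (-(f q₀ : ℂ) * φ x * e) * Complex.I_mul_I
  have e2 : -(1 / 2) * ((φ'' x : ℂ) * e) + (f (φ x ^ 2) : ℂ) * (φ x * e) +
      ((ε * V x : ℝ) : ℂ) * (φ x * e) =
      ((-(1 / 2) * φ'' x + f (φ x ^ 2) * φ x + ε * V x * φ x : ℝ) : ℂ) * e := by
    push_cast; ring
  rw [e1, e2, mul_left_inj' he0, Complex.ofReal_inj]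
  constructor <;> intro h <;> linarith

/-- Kink modes are the heteroclinic solutions of the stationary equation. -/
theorem isKinkMode_iff {f V φ : ℝ → ℝ} {q₀ ε : ℝ}
    (hg : Continuous (stationaryNonlinearity f q₀)) (hV : Continuous V) :
    IsKinkMode f V q₀ ε φ ↔ ∃ φ' : ℝ → ℝ, (∀ x, HasDerivAt φ (φ' x) x) ∧
      (∀ x, HasDerivAt φ' (stationaryNonlinearity f q₀ (φ x) + 2 * ε * (V x * φ x)) x) ∧
      RightDecay (fun x => φ x - √q₀) ∧ RightDecay fun x => φ (-x) + √q₀ := by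
  constructor
  · rintro ⟨hc, hs, hl⟩
    have hd : ∀ x, HasDerivAt φ (deriv φ x) x := fun x =>
      (hc.differentiable two_ne_zero x).hasDerivAt
    have hd' : ∀ x, HasDerivAt (deriv φ) (deriv (deriv φ) x) x := fun x =>
      (((contDiff_succ_iff_deriv (n := 1)).1 hc).2.2.differentiable one_ne_zero x).hasDerivAt
    refine ⟨deriv φ, hd, fun x => ?_, convergesExponentially_iff.1 hl⟩
    rw [← (standingWave_equation_iff hd hd' 0 x 0).1 ((hs 0).2.2 x 0)]
    exact hd' x
  · rintro ⟨φ', hd, hd', hl⟩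
    have hφc : Continuous φ := continuous_iff_continuousAt.2 fun x => (hd x).continuousAt
    have hc : ContDiff ℝ 2 φ := by
      refine (contDiff_succ_iff_deriv (n := 1)).2
        ⟨fun x => (hd x).differentiableAt, by simp, ?_⟩
      rw [funext fun x => (hd x).deriv, contDiff_one_iff_deriv]
      refine ⟨fun x => (hd' x).differentiableAt, ?_⟩
      rw [funext fun x => (hd' x).deriv]
      exact (hg.comp hφc).add (continuous_const.mul (hV.mul hφc))
    refine ⟨hc, fun θ => ⟨fun t => ?_, fun x t => ?_, fun x t => ?_⟩,
      convergesExponentially_iff.2 hl⟩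
    · exact (Complex.ofRealCLM.contDiff.comp hc).mul contDiff_const
    · exact (hasDerivAt_standingWave_time φ (f q₀) θ x t).differentiableAt
    · exact (standingWave_equation_iff hd hd' θ x t).2 rfl

/-! ### Nonlinear heteroclinic solutions: energy identity and decay -/

theorem RightDecay.comp_add_const {z : ℝ → ℝ} (hz : RightDecay z) (b : ℝ) :
    RightDecay fun x => z (x + b) := by
  obtain ⟨C, κ, hκ, h⟩ := hz
  refine ⟨C * Real.exp (-κ * b), κ, hκ, fun x => (h _).trans (le_of_eq ?_)⟩
  rw [mul_assoc, ← Real.exp_add]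
  ring_nf

theorem IsHeteroclinic.comp_sub_const {g k p : ℝ → ℝ} {a : ℝ} (K : IsHeteroclinic g a k p)
    (s : ℝ) : IsHeteroclinic g a (fun x => k (x - s)) (fun x => p (x - s)) where
  hasDerivAt x := (K.hasDerivAt (x - s)).comp_sub_const x s
  hasDerivAt' x := (K.hasDerivAt' (x - s)).comp_sub_const x s
  right := by simpa only [sub_eq_add_neg] using K.right.comp_add_const (-s)
  left := by simpa only [neg_add'] using K.left.comp_add_const s

theorem tendsto_deriv_zero_atBot {u u' u'' : ℝ → ℝ} {l : ℝ} (hu : ∀ x, HasDerivAt u (u' x) x)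
    (hu' : ∀ x, HasDerivAt u' (u'' x) x) (hl : Tendsto u atBot (𝓝 l))
    (h0 : Tendsto u'' atBot (𝓝 0)) : Tendsto u' atBot (𝓝 0) := by
  have h := tendsto_deriv_zero (u := fun x => u (-x)) (u' := fun x => -u' (-x))
    (u'' := fun x => u'' (-x)) (fun x => by
      convert! (hu (-x)).comp x (hasDerivAt_neg x) using 1; simp) (fun x => by
      convert! ((hu' (-x)).comp x (hasDerivAt_neg x)).neg using 1; simp)
    (hl.comp tendsto_neg_atTop_atBot) (h0.comp tendsto_neg_atTop_atBot)
  simpa [Function.comp_def] using (h.comp tendsto_neg_atBot_atTop).neg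

namespace OddBistable

variable {g Φ Φ' ρ : ℝ → ℝ} {a : ℝ}

theorem tendsto_deriv (N : OddBistable g a) (hΦ : ∀ x, HasDerivAt Φ (Φ' x) x)
    (hΦ' : ∀ x, HasDerivAt Φ' (g (Φ x) + ρ x) x)
    (ht : Tendsto Φ atTop (𝓝 a)) (hb : Tendsto Φ atBot (𝓝 (-a)))
    (hρt : Tendsto ρ atTop (𝓝 0)) (hρb : Tendsto ρ atBot (𝓝 0)) :
    Tendsto Φ' atTop (𝓝 0) ∧ Tendsto Φ' atBot (𝓝 0) := by
  have h1 := ((N.contDiff.continuous.tendsto a).comp ht).add hρt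
  have h2 := ((N.contDiff.continuous.tendsto (-a)).comp hb).add hρb
  rw [N.zero, add_zero] at h1
  rw [N.odd, N.zero, neg_zero, add_zero] at h2
  exact ⟨tendsto_deriv_zero hΦ hΦ' ht h1, tendsto_deriv_zero_atBot hΦ hΦ' hb h2⟩

/-- Energy identity: the forcing does no work along a heteroclinic solution. -/
theorem integral_forcing_eq_zero (N : OddBistable g a) (hΦ : ∀ x, HasDerivAt Φ (Φ' x) x)
    (hΦ' : ∀ x, HasDerivAt Φ' (g (Φ x) + ρ x) x)
    (ht : Tendsto Φ atTop (𝓝 a)) (hb : Tendsto Φ atBot (𝓝 (-a)))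
    (hρt : Tendsto ρ atTop (𝓝 0)) (hρb : Tendsto ρ atBot (𝓝 0))
    (hi : MeasureTheory.Integrable fun x => ρ x * Φ' x) : ∫ x, ρ x * Φ' x = 0 := by
  obtain ⟨ht', hb'⟩ := N.tendsto_deriv hΦ hΦ' ht hb hρt hρb
  let G : ℝ → ℝ := fun u => ∫ v in (0 : ℝ)..u, g v
  have hG : ∀ u, HasDerivAt G (g u) u := fun u =>
    (N.contDiff.continuous.integral_hasStrictDerivAt 0 u).hasDerivAt
  have hGc : Continuous G := continuous_iff_continuousAt.2 fun u => (hG u).continuousAt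
  -- The primitive of an odd function is even, so the energy `Φ'²/2 - G(Φ)` has the same limit at
  -- both ends.
  have hGe : G (-a) = G a := by
    have := intervalIntegral.integral_comp_neg (a := 0) (b := a) g
    simp only [N.odd, intervalIntegral.integral_neg, neg_zero] at this
    change ∫ v in (0 : ℝ)..-a, g v = _
    rw [intervalIntegral.integral_symm, ← this, neg_neg]
  have hd : ∀ x, HasDerivAt (fun x => Φ' x ^ 2 / 2 - G (Φ x)) (ρ x * Φ' x) x := fun x => by
    convert! (((hΦ' x).pow 2).div_const 2).sub ((hG (Φ x)).comp x (hΦ x)) using 1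
    push_cast; ring
  have l1 := ((ht'.pow 2).div_const 2).sub ((hGc.tendsto a).comp ht)
  have l2 := ((hb'.pow 2).div_const 2).sub ((hGc.tendsto (-a)).comp hb)
  rw [MeasureTheory.integral_of_hasDerivAt_of_tendsto hd hi l2 l1, hGe, sub_self]

end OddBistable

/-- Solutions of `Φ'' = g Φ + ρ` uniformly close to a kink, with exponentially decaying forcing,
converge exponentially to the same limits. -/
theorem IsHeteroclinic.exists_rightDecay_of_near {g k p : ℝ → ℝ} {a : ℝ} (N : OddBistable g a)
    (K : IsHeteroclinic g a k p) : ∃ r > 0, ∀ Φ Φ' ρ : ℝ → ℝ,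
      (∀ x, HasDerivAt Φ (Φ' x) x) → (∀ x, HasDerivAt Φ' (g (Φ x) + ρ x) x) →
      RightDecay ρ → RightDecay (fun x => ρ (-x)) → (∀ x, |Φ x - k x| ≤ r) →
      RightDecay (fun x => Φ x - a) ∧ RightDecay fun x => Φ (-x) + a := by
  obtain ⟨r, m, M, hr, hm, hmM, hb⟩ := exists_slope_bounds N.contDiff N.zero N.deriv_pos
  have key : ∀ k p : ℝ → ℝ, IsHeteroclinic g a k p → ∀ Φ Φ' ρ : ℝ → ℝ,
      (∀ x, HasDerivAt Φ (Φ' x) x) → (∀ x, HasDerivAt Φ' (g (Φ x) + ρ x) x) →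
      RightDecay ρ → (∀ x, |Φ x - k x| ≤ r / 2) → RightDecay (fun x => Φ x - a) := by
    intro k p K Φ Φ' ρ hΦ hΦ' hρ hnear
    obtain ⟨B, hB⟩ := K.exists_bound
    obtain ⟨X, hX⟩ := eventually_atTop.1
      -- Half of `r` is spent on the distance from `k` to `a`, the other half on the distance from
      -- `Φ` to `k`.
      (K.tendsto_atTop.eventually (Metric.closedBall_mem_nhds a (half_pos hr)))
    refine rightDecay_sub_of_near_equilibrium (B := r / 2 + B) (X := X) hm hb hΦ hΦ' hρ
      (fun x => ?_) fun x hx => ?_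
    · have := abs_add_le (Φ x - k x) (k x)
      rw [sub_add_cancel] at this
      linarith [hnear x, hB x]
    · have h1 := hX x hx
      rw [Real.dist_eq] at h1
      have := abs_sub_le (Φ x) (k x) a
      linarith [hnear x]
  refine ⟨r / 2, half_pos hr, fun Φ Φ' ρ hΦ hΦ' hρ hρ' hnear =>
    ⟨key k p K Φ Φ' ρ hΦ hΦ' hρ hnear, ?_⟩⟩
  have h := key _ _ (K.reflect N) (fun x => -Φ (-x)) (fun x => Φ' (-x)) (fun x => -ρ (-x))
    (fun x => by
      convert! ((hΦ (-x)).comp x (hasDerivAt_neg x)).neg using 1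
      simp)
    (fun x => by
      convert! (hΦ' (-x)).comp x (hasDerivAt_neg x) using 1
      rw [N.odd]; ring)
    hρ'.neg (fun x => by
      rw [neg_sub_neg, abs_sub_comm]
      exact hnear (-x))
  exact h.of_le (B := 1) fun x => by rw [one_mul, ← neg_add', abs_neg]

/-! ### The effective force and its derivative -/

namespace IsHeteroclinic

variable {g φ p V M' : ℝ → ℝ} {a : ℝ}

theorem exists_deriv_bound (N : OddBistable g a) (K : IsHeteroclinic g a φ p) :
    ∃ B, 0 < B ∧ ∀ x, |p x| ≤ B := by
  obtain ⟨B, hB⟩ := exists_abs_le_of_tendsto K.continuous' (K.deriv_tendsto_atTop N)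
    (K.deriv_tendsto_atBot N)
  exact ⟨B, (abs_pos.2 (K.deriv_ne_zero N 0)).trans_le (hB 0), hB⟩

theorem abs_sub_le (N : OddBistable g a) (K : IsHeteroclinic g a φ p) :
    ∃ B, 0 < B ∧ ∀ x y, |φ x - φ y| ≤ B * |x - y| := by
  obtain ⟨B, hB0, hB⟩ := K.exists_deriv_bound N
  exact ⟨B, hB0, fun x y => convex_univ.norm_image_sub_le_of_norm_hasDerivWithin_le
    (fun z _ => (K.hasDerivAt z).hasDerivWithinAt) (fun z _ => hB z) trivial trivial⟩

/-- Integration by parts moves the derivative in the effective force from the potential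
to the kink. -/
theorem effectiveForce_eq (N : OddBistable g a) (K : IsHeteroclinic g a φ p) {q₀ : ℝ}
    (hV : ContDiff ℝ 1 V) (hVi : MeasureTheory.Integrable V) (ht : Tendsto V atTop (𝓝 0))
    (hb : Tendsto V atBot (𝓝 0)) (hM : IsEffectiveForce V q₀ φ M') (s : ℝ) :
    M' s = 2 * ∫ x, V x * (φ (x - s) * p (x - s)) := by
  obtain ⟨B, hB⟩ := K.exists_bound
  obtain ⟨B', hB'0, hB'⟩ := K.exists_deriv_bound N
  have hsub : Continuous fun x : ℝ => x - s := continuous_sub_right s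
  have hU : ∀ x, HasDerivAt (fun x => q₀ - φ (x - s) ^ 2) (-(2 * (φ (x - s) * p (x - s)))) x :=
    fun x => by
      convert! (((K.hasDerivAt (x - s)).comp_sub_const x s).pow 2).const_sub q₀ using 1
      push_cast; ring
  have hUc : Continuous fun x => -(2 * (φ (x - s) * p (x - s))) :=
    (continuous_const.mul ((K.continuous.comp hsub).mul (K.continuous'.comp hsub))).neg
  have hVd : ∀ x, HasDerivAt V (deriv V x) x := fun x =>
    (hV.differentiable one_ne_zero x).hasDerivAt
  have hV'c := hV.continuous_deriv le_rfl
  have hVUi : MeasureTheory.Integrable fun x => V x * -(2 * (φ (x - s) * p (x - s))) := by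
    refine hVi.mul_bdd (c := 2 * (B * B')) hUc.aestronglyMeasurable
      (Eventually.of_forall fun x => ?_)
    rw [norm_neg, norm_mul, norm_mul, Real.norm_two]
    have := (abs_nonneg _).trans (hB 0)
    gcongr
    exacts [hB _, hB' _]
  have hibp : ∀ R : ℝ, ∫ x in (-R)..R, deriv V x * (q₀ - φ (x - s) ^ 2) =
      V R * (q₀ - φ (R - s) ^ 2) - V (-R) * (q₀ - φ (-R - s) ^ 2) -
        ∫ x in (-R)..R, V x * -(2 * (φ (x - s) * p (x - s))) := fun R => by
    rw [← intervalIntegral.integral_deriv_mul_eq_sub (fun x _ => hVd x) (fun x _ => hU x)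
      (hV'c.intervalIntegrable _ _) (hUc.intervalIntegrable _ _),
      ← intervalIntegral.integral_sub]
    · simp
    · refine Continuous.intervalIntegrable ?_ _ _
      exact (hV'c.mul (continuous_iff_continuousAt.2 fun x => (hU x).continuousAt)).add
        (hV.continuous.mul hUc)
    · exact (hV.continuous.mul hUc).intervalIntegrable _ _
  -- The boundary terms vanish because `V` does, the factor `q₀ - φ²` being merely bounded; no decay
  -- of `V'` is needed for the symmetric limit.
  have hbdd : ∀ (u : ℝ → ℝ) , Tendsto (fun R => V (u R)) atTop (𝓝 0) →
      Tendsto (fun R => V (u R) * (q₀ - φ (u R - s) ^ 2)) atTop (𝓝 0) := fun u hu => by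
    refine hu.zero_mul_isBoundedUnder_le (isBoundedUnder_of ⟨|q₀| + B ^ 2, fun R => ?_⟩)
    refine (norm_sub_le _ _).trans ?_
    rw [norm_pow]
    gcongr
    · exact le_rfl
    · exact hB _
  have hlim := ((hbdd id ht).sub (hbdd (fun R => -R) (hb.comp tendsto_neg_atTop_atBot))).sub
    (MeasureTheory.intervalIntegral_tendsto_integral hVUi tendsto_neg_atTop_atBot tendsto_id)
  have h := tendsto_nhds_unique (hM s) (hlim.congr fun R => (hibp R).symm)
  rw [h, sub_zero, zero_sub, ← MeasureTheory.integral_neg, ← MeasureTheory.integral_const_mul]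
  congr 1
  funext x
  ring

/-- After integration by parts the shift acts only on the kink, whose derivatives are `p` and
`g(φ)`, all bounded; a multiple of `|V|` dominates. The result is `-2` times the number that must be
nonzero in the bordered problem. -/
theorem hasDerivAt_effectiveForce (N : OddBistable g a) (K : IsHeteroclinic g a φ p) {q₀ : ℝ}
    (hV : ContDiff ℝ 1 V) (hVi : MeasureTheory.Integrable V) (ht : Tendsto V atTop (𝓝 0))
    (hb : Tendsto V atBot (𝓝 0)) (hM : IsEffectiveForce V q₀ φ M') (s : ℝ) :
    HasDerivAt M' (2 * ∫ x, -(V x * (p (x - s) * p (x - s) + φ (x - s) * g (φ (x - s))))) s := by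
  obtain ⟨B, hB⟩ := K.exists_bound
  obtain ⟨B', hB'0, hB'⟩ := K.exists_deriv_bound N
  obtain ⟨D, hD⟩ := (isCompact_Icc (a := -B) (b := B)).exists_bound_of_continuousOn
    N.contDiff.continuous.continuousOn
  have hB0 : 0 ≤ B := (abs_nonneg _).trans (hB 0)
  have hgB : ∀ x, ‖g (φ x)‖ ≤ D := fun x => hD _ (abs_le.1 (hB x))
  have hc1 : ∀ s, Continuous fun x => V x * (φ (x - s) * p (x - s)) := fun s =>
    hV.continuous.mul ((K.continuous.comp (continuous_sub_right s)).mul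
      (K.continuous'.comp (continuous_sub_right s)))
  have hc2 : Continuous fun x => -(V x * (p (x - s) * p (x - s) + φ (x - s) * g (φ (x - s)))) := by
    have h1 := K.continuous.comp (continuous_sub_right s)
    have h2 := K.continuous'.comp (continuous_sub_right s)
    exact (hV.continuous.mul ((h2.mul h2).add (h1.mul (N.contDiff.continuous.comp h1)))).neg
  rw [funext fun s => K.effectiveForce_eq N hV hVi ht hb hM s]
  refine HasDerivAt.const_mul 2 (hasDerivAt_integral_of_dominated_loc_of_deriv_le
    (F := fun s x => V x * (φ (x - s) * p (x - s)))
    (F' := fun s x => -(V x * (p (x - s) * p (x - s) + φ (x - s) * g (φ (x - s)))))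
    (bound := fun x => ‖V x‖ * (B' * B' + B * D)) univ_mem
    (Eventually.of_forall fun s => (hc1 s).aestronglyMeasurable) ?_ hc2.aestronglyMeasurable
    (Eventually.of_forall fun x s _ => ?_) (hVi.norm.mul_const _)
    (Eventually.of_forall fun x s _ => ?_)).2
  · refine hVi.mul_bdd (c := B * B') ((K.continuous.comp (continuous_sub_right s)).mul
      (K.continuous'.comp (continuous_sub_right s))).aestronglyMeasurable
      (Eventually.of_forall fun x => ?_)
    rw [norm_mul]
    gcongr
    exacts [hB _, hB' _]
  · rw [norm_neg, norm_mul]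
    gcongr
    refine (norm_add_le _ _).trans ?_
    rw [norm_mul, norm_mul]
    gcongr
    exacts [hB' _, hB' _, hB _, hgB _]
  · convert! (((K.hasDerivAt (x - s)).comp_const_sub x s).mul
      ((K.hasDerivAt' (x - s)).comp_const_sub x s)).const_mul (V x) using 1
    ring

end IsHeteroclinic

/-! ### Fixing the position by orthogonality -/

/-- Overlap of the deviation of the shifted profile `Φ (· + s)` from `φ` with the weight `p`. -/
noncomputable def displacement (φ p Φ : ℝ → ℝ) (s : ℝ) : ℝ :=
  ∫ x, p x * (Φ (x + s) - φ x)

namespace IsHeteroclinic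

variable {g φ p Φ Φ' Ψ : ℝ → ℝ} {a : ℝ}

theorem integrable_displacement (N : OddBistable g a) (K : IsHeteroclinic g a φ p)
    (hΦ : Continuous Φ) {B : ℝ} (hB : ∀ x, |Φ x| ≤ B) (s : ℝ) :
    MeasureTheory.Integrable fun x => p x * (Φ (x + s) - φ x) := by
  obtain ⟨B', hB'⟩ := K.exists_bound
  refine (K.integrable_deriv N).mul_bdd (c := B + B')
    ((hΦ.comp (continuous_add_const s)).sub K.continuous).aestronglyMeasurable
    (Eventually.of_forall fun x => (norm_sub_le _ _).trans (add_le_add (hB _) (hB' _)))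

theorem abs_displacement_sub_le (N : OddBistable g a) (K : IsHeteroclinic g a φ p)
    (hΦ : Continuous Φ) (hΨ : Continuous Ψ) {B d : ℝ} (hB : ∀ x, |Φ x| ≤ B)
    (hB' : ∀ x, |Ψ x| ≤ B) (hd : ∀ x, |Φ x - Ψ x| ≤ d) (s : ℝ) :
    |displacement φ p Φ s - displacement φ p Ψ s| ≤ (∫ x, p x) * d := by
  rw [displacement, displacement, ← MeasureTheory.integral_sub
    (K.integrable_displacement N hΦ hB s) (K.integrable_displacement N hΨ hB' s),
    ← MeasureTheory.integral_mul_const, ← Real.norm_eq_abs]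
  refine MeasureTheory.norm_integral_le_of_norm_le ((K.integrable_deriv N).mul_const d)
    (Eventually.of_forall fun x => ?_)
  rw [← mul_sub, sub_sub_sub_cancel_right, norm_mul, Real.norm_of_nonneg (K.deriv_pos N x).le]
  exact mul_le_mul_of_nonneg_left (hd _) (K.deriv_pos N x).le

theorem continuous_displacement (N : OddBistable g a) (K : IsHeteroclinic g a φ p)
    (hΦ : Continuous Φ) {B : ℝ} (hB : ∀ x, |Φ x| ≤ B) : Continuous (displacement φ p Φ) := by
  obtain ⟨B', hB'⟩ := K.exists_bound
  refine MeasureTheory.continuous_of_dominated (bound := fun x => p x * (B + B'))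
    (fun s => (K.integrable_displacement N hΦ hB s).aestronglyMeasurable)
    (fun s => Eventually.of_forall fun x => ?_) ((K.integrable_deriv N).mul_const _)
    (Eventually.of_forall fun x => ?_)
  · rw [norm_mul, Real.norm_of_nonneg (K.deriv_pos N x).le]
    exact mul_le_mul_of_nonneg_left ((norm_sub_le _ _).trans (add_le_add (hB _) (hB' _)))
      (K.deriv_pos N x).le
  · exact continuous_const.mul ((hΦ.comp (continuous_const_add x)).sub continuous_const)

/-- The displacement is uniformly increasing in the shift for profiles `C¹`-close to a translate
of the kink, so the orthogonality condition determines the position. -/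
theorem exists_displacement_slope (N : OddBistable g a) (K : IsHeteroclinic g a φ p) (s₀ : ℝ) :
    ∃ η > 0, ∃ c > 0, ∀ Φ Φ' : ℝ → ℝ, (∀ x, HasDerivAt Φ (Φ' x) x) → (∃ B, ∀ x, |Φ x| ≤ B) →
      (∀ x, |Φ' x - p (x - s₀)| ≤ η) → ∀ s₁ s₂, s₁ ≤ s₂ → |s₁ - s₀| ≤ 1 → |s₂ - s₀| ≤ 1 →
        c * (s₂ - s₁) ≤ displacement φ p Φ s₂ - displacement φ p Φ s₁ := by
  have hp := K.deriv_pos N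
  have hpi := K.integrable_deriv N
  -- For `x ∈ [-1, 1]` and shifts within `1` of `s₀`, the argument of the translated `p` lies in
  -- `[-2, 2]`.
  obtain ⟨x₀, -, hx₀⟩ := (isCompact_Icc (a := (-2 : ℝ)) (b := 2)).exists_isMinOn
    ⟨0, by norm_num⟩ K.continuous'.continuousOn
  set m := p x₀
  have hm : 0 < m := hp x₀
  set A := ∫ x in Set.Icc (-1 : ℝ) 1, p x with hA
  set I := ∫ x, p x with hI
  have hA0 : 0 < A := by
    rw [hA, MeasureTheory.integral_Icc_eq_integral_Ioc, ← intervalIntegral.integral_of_le (by norm_num)]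
    exact intervalIntegral.intervalIntegral_pos_of_pos (K.continuous'.intervalIntegrable _ _) hp
      (by norm_num)
  have hI0 : 0 < I := MeasureTheory.integral_pos_of_integrable_nonneg_nonzero (x := 0)
    K.continuous' hpi (fun x => (hp x).le) (hp 0).ne'
  -- The slope is at least `mA - ηI`: the window `[-1, 1]` gives `mA`, and the error `η` in `Φ'`
  -- costs at most `ηI`. This `η` leaves half.
  refine ⟨m * A / (2 * I), by positivity, m * A / 2, by positivity,
    fun Φ Φ' hΦ ⟨B, hB⟩ hη s₁ s₂ hs h₁ h₂ => ?_⟩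
  rcases hs.eq_or_lt with rfl | hs
  · simp
  have hΦc : Continuous Φ := continuous_iff_continuousAt.2 fun x => (hΦ x).continuousAt
  set η := m * A / (2 * I) with hηdef
  rw [abs_le] at h₁ h₂
  have hpt : ∀ x, (s₂ - s₁) * ((Set.Icc (-1 : ℝ) 1).indicator p x * m - p x * η) ≤
      p x * (Φ (x + s₂) - φ x) - p x * (Φ (x + s₁) - φ x) := fun x => by
    obtain ⟨z, hz, hz'⟩ := exists_hasDerivAt_eq_slope Φ Φ' (add_lt_add_right hs x)
      hΦc.continuousOn (fun y _ => hΦ y)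
    have e : Φ (x + s₂) - Φ (x + s₁) = Φ' z * (s₂ - s₁) := by
      rw [hz', add_sub_add_left_eq_sub, div_mul_cancel₀ _ (sub_ne_zero.2 hs.ne')]
    have h3 : p (z - s₀) - η ≤ Φ' z := by linarith [(abs_le.1 (hη z)).1]
    have h4 : (Set.Icc (-1 : ℝ) 1).indicator p x * m ≤ p x * p (z - s₀) := by
      by_cases hx : x ∈ Set.Icc (-1 : ℝ) 1
      · rw [Set.indicator_of_mem hx]
        refine mul_le_mul_of_nonneg_left (hx₀ ?_) (hp x).le
        constructor <;> linarith [hx.1, hx.2, hz.1, hz.2]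
      · rw [Set.indicator_of_notMem hx, zero_mul]
        exact (mul_pos (hp _) (hp _)).le
    have h5 := mul_le_mul_of_nonneg_left h3 (hp x).le
    have h6 : p x * (Φ (x + s₂) - φ x) - p x * (Φ (x + s₁) - φ x) =
        (s₂ - s₁) * (p x * Φ' z) := by rw [← mul_sub, sub_sub_sub_cancel_right, e]; ring
    rw [h6]
    refine mul_le_mul_of_nonneg_left ?_ (sub_pos.2 hs).le
    linarith
  have hind : MeasureTheory.Integrable ((Set.Icc (-1 : ℝ) 1).indicator p) :=
    hpi.indicator measurableSet_Icc
  have hint := MeasureTheory.integral_mono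
    (((hind.mul_const m).sub (hpi.mul_const η)).const_mul (s₂ - s₁))
    ((K.integrable_displacement N hΦc hB s₂).sub (K.integrable_displacement N hΦc hB s₁)) hpt
  simp only [Pi.sub_apply] at hint
  rw [MeasureTheory.integral_const_mul, MeasureTheory.integral_sub (hind.mul_const m)
    (hpi.mul_const η), MeasureTheory.integral_mul_const, MeasureTheory.integral_mul_const,
    MeasureTheory.integral_indicator measurableSet_Icc,
    MeasureTheory.integral_sub (K.integrable_displacement N hΦc hB s₂)
      (K.integrable_displacement N hΦc hB s₁)] at hint
  refine le_trans (le_of_eq ?_) hint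
  rw [← hA, ← hI, hηdef]
  field_simp
  ring

/-- At `s₀` the displacement is at most `d ∫ p` in absolute value. With slope at least `c`, moving
by `d ∫ p / c` either way forces a sign change. -/
theorem exists_displacement_eq_zero (N : OddBistable g a) (K : IsHeteroclinic g a φ p) {s₀ c d : ℝ}
    (hc : 0 < c) (hΦ : Continuous Φ) {B : ℝ} (hB : ∀ x, |Φ x| ≤ B)
    (hd : ∀ x, |Φ x - φ (x - s₀)| ≤ d) (hdc : (∫ x, p x) / c * d ≤ 1)
    (hslope : ∀ s₁ s₂, s₁ ≤ s₂ → |s₁ - s₀| ≤ 1 → |s₂ - s₀| ≤ 1 →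
        c * (s₂ - s₁) ≤ displacement φ p Φ s₂ - displacement φ p Φ s₁) :
    ∃ s, |s - s₀| ≤ (∫ x, p x) / c * d ∧ displacement φ p Φ s = 0 := by
  set I := ∫ x, p x
  have hI0 : 0 ≤ I := MeasureTheory.integral_nonneg fun x => (K.deriv_pos N x).le
  have hd0 : 0 ≤ d := (abs_nonneg _).trans (hd 0)
  obtain ⟨B', hB'⟩ := K.exists_bound
  have h0 : displacement φ p (fun x => φ (x - s₀)) s₀ = 0 := by simp [displacement]
  have h1 := K.abs_displacement_sub_le N hΦ (K.continuous.comp (continuous_sub_right s₀))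
    (B := max B B') (fun x => (hB x).trans (le_max_left _ _))
    (fun x => (hB' _).trans (le_max_right _ _)) hd s₀
  simp only [Function.comp_def] at h1
  rw [h0, sub_zero, abs_le] at h1
  set D := I / c * d
  have hD0 : 0 ≤ D := by positivity
  have hcD : c * D = I * d := by simp only [D]; field_simp
  have e0 : |s₀ - s₀| ≤ 1 := by simp
  have e1 : |s₀ + D - s₀| ≤ 1 := by rwa [add_sub_cancel_left, abs_of_nonneg hD0]
  have e2 : |s₀ - D - s₀| ≤ 1 := by
    rwa [sub_sub_cancel_left, abs_neg, abs_of_nonneg hD0]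
  have h2 := hslope s₀ (s₀ + D) (by linarith) e0 e1
  have h3 := hslope (s₀ - D) s₀ (by linarith) e2 e0
  rw [add_sub_cancel_left] at h2
  rw [sub_sub_cancel] at h3
  obtain ⟨s, hs, hs'⟩ := intermediate_value_Icc (by linarith : s₀ - D ≤ s₀ + D)
    (K.continuous_displacement N hΦ hB).continuousOn
    (⟨by linarith [h1.1, h1.2], by linarith [h1.1, h1.2]⟩ :
      (0 : ℝ) ∈ Set.Icc (displacement φ p Φ (s₀ - D)) (displacement φ p Φ (s₀ + D)))
  exact ⟨s, abs_le.2 ⟨by linarith [hs.1], by linarith [hs.2]⟩, hs'⟩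

end IsHeteroclinic

/-! ### The exact Melnikov condition and the vanishing multiplier -/

namespace IsHeteroclinic

variable {g k p V Φ Φ' : ℝ → ℝ} {a ε : ℝ}

/-- A heteroclinic solution of the perturbed equation satisfies the exact Melnikov condition,
and its derivative is bounded. -/
theorem integral_potential_eq_zero (N : OddBistable g a) (hVi : MeasureTheory.Integrable V)
    (ht : Tendsto V atTop (𝓝 0)) (hb : Tendsto V atBot (𝓝 0)) (hε : ε ≠ 0)
    (hΦ : ∀ x, HasDerivAt Φ (Φ' x) x)
    (hΦ' : ∀ x, HasDerivAt Φ' (g (Φ x) + 2 * ε * (V x * Φ x)) x)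
    (hr : RightDecay fun x => Φ x - a) (hl : RightDecay fun x => Φ (-x) + a) :
    (∃ B, ∀ x, |Φ' x| ≤ B) ∧ ∫ x, V x * (Φ x * Φ' x) = 0 := by
  have hΦc : Continuous Φ := continuous_iff_continuousAt.2 fun x => (hΦ x).continuousAt
  have hΦ'c : Continuous Φ' := continuous_iff_continuousAt.2 fun x => (hΦ' x).continuousAt
  have lt : Tendsto Φ atTop (𝓝 a) := by simpa using hr.tendsto.add_const a
  have lb : Tendsto Φ atBot (𝓝 (-a)) := by
    simpa [Function.comp_def] using (hl.tendsto.comp tendsto_neg_atBot_atTop).sub_const a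
  have h1 : Tendsto (fun x => 2 * ε * (V x * Φ x)) atTop (𝓝 0) := by
    simpa using (ht.mul lt).const_mul (2 * ε)
  have h2 : Tendsto (fun x => 2 * ε * (V x * Φ x)) atBot (𝓝 0) := by
    simpa using (hb.mul lb).const_mul (2 * ε)
  obtain ⟨lt', lb'⟩ := N.tendsto_deriv hΦ hΦ' lt lb h1 h2
  obtain ⟨B, hB⟩ := exists_abs_le_of_tendsto hΦc lt lb
  obtain ⟨B', hB'⟩ := exists_abs_le_of_tendsto hΦ'c lt' lb'
  have e : (fun x => 2 * ε * (V x * Φ x) * Φ' x) = fun x => 2 * ε * (V x * (Φ x * Φ' x)) := by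
    funext x; ring
  have hi : MeasureTheory.Integrable fun x => V x * (Φ x * Φ' x) := by
    refine hVi.mul_bdd (c := B * B') (hΦc.mul hΦ'c).aestronglyMeasurable
      (Eventually.of_forall fun x => ?_)
    rw [norm_mul]
    have := (abs_nonneg _).trans (hB 0)
    gcongr
    exacts [hB _, hB' _]
  have h3 := N.integral_forcing_eq_zero hΦ hΦ' lt lb h1 h2 (by rw [e]; exact hi.const_mul _)
  rw [e, MeasureTheory.integral_const_mul] at h3
  exact ⟨⟨B', hB'⟩, (mul_eq_zero.1 h3).resolve_left (by simpa using hε)⟩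

/-- Solutions of the bordered problem close to the kink are heteroclinic solutions of the
perturbed equation: the multiplier vanishes. -/
theorem multiplier_eq_zero (N : OddBistable g a) (K : IsHeteroclinic g a k p)
    (hVi : MeasureTheory.Integrable V) (hVr : RightDecay V) (hVl : RightDecay fun x => V (-x))
    {BV r θ c : ℝ} (hVB : ∀ x, |V x| ≤ BV) (hΦ : ∀ x, HasDerivAt Φ (Φ' x) x)
    (hΦ' : ∀ x, HasDerivAt Φ' (g (Φ x) + (2 * ε * (V x * Φ x) - c * p x)) x)
    (h0 : ∫ x, V x * (Φ x * Φ' x) = 0) (hnear : ∀ x, |Φ x - k x| ≤ r)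
    (hnear' : ∀ x, |Φ' x - p x| ≤ θ) (hθ : (∫ x, p x) * θ < ∫ x, p x * p x)
    (hdecay : ∀ Φ Φ' ρ : ℝ → ℝ,
      (∀ x, HasDerivAt Φ (Φ' x) x) → (∀ x, HasDerivAt Φ' (g (Φ x) + ρ x) x) →
      RightDecay ρ → RightDecay (fun x => ρ (-x)) → (∀ x, |Φ x - k x| ≤ r) →
      RightDecay (fun x => Φ x - a) ∧ RightDecay fun x => Φ (-x) + a) :
    c = 0 ∧ RightDecay (fun x => Φ x - a) ∧ RightDecay fun x => Φ (-x) + a := by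
  have hΦc : Continuous Φ := continuous_iff_continuousAt.2 fun x => (hΦ x).continuousAt
  have hΦ'c : Continuous Φ' := continuous_iff_continuousAt.2 fun x => (hΦ' x).continuousAt
  have hp := K.deriv_pos N
  have hpi := K.integrable_deriv N
  obtain ⟨B, hB⟩ := K.exists_bound
  obtain ⟨Bp, hBp0, hBp⟩ := K.exists_deriv_bound N
  have hΦB : ∀ x, |Φ x| ≤ r + B := fun x => by
    have := abs_add_le (Φ x - k x) (k x)
    rw [sub_add_cancel] at this
    linarith [hnear x, hB x]
  have hΦ'B : ∀ x, |Φ' x| ≤ θ + Bp := fun x => by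
    have := abs_add_le (Φ' x - p x) (p x)
    rw [sub_add_cancel] at this
    linarith [hnear' x, hBp x]
  have hVΦ : ∀ x, |2 * ε * (V x * Φ x)| ≤ |2 * ε| * (r + B) * |V x| := fun x => by
    rw [abs_mul, abs_mul (V x), mul_assoc, mul_comm (r + B)]
    gcongr
    exact hΦB x
  have hcp : ∀ x, |-(c * p x)| ≤ |c| * |p x| := fun x => by rw [abs_neg, abs_mul]
  have hrB : 0 ≤ r + B := (abs_nonneg _).trans (hΦB 0)
  have hbd : ∀ x, |2 * ε * (V x * Φ x) + -(c * p x)| ≤ |2 * ε| * (r + B) * BV + |c| * Bp := fun x => by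
    refine (abs_add_le _ _).trans (add_le_add ((hVΦ x).trans ?_) ((hcp x).trans ?_))
    · gcongr; exact hVB x
    · gcongr; exact hBp x
  have hρr : RightDecay fun x => 2 * ε * (V x * Φ x) - c * p x := by
    simp only [sub_eq_add_neg]
    exact (hVr.of_le hVΦ).add ((K.rightDecay_deriv N).of_le hcp) hbd
  have hρl : RightDecay fun x => 2 * ε * (V (-x) * Φ (-x)) - c * p (-x) := by
    simp only [sub_eq_add_neg]
    exact (hVl.of_le fun x => hVΦ (-x)).add
      (((K.reflect N).rightDecay_deriv N).of_le fun x => hcp (-x)) fun x => hbd (-x)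
  obtain ⟨hr, hl⟩ := hdecay Φ Φ' _ hΦ hΦ' hρr hρl hnear
  refine ⟨?_, hr, hl⟩
  have lt : Tendsto Φ atTop (𝓝 a) := by simpa using hr.tendsto.add_const a
  have lb : Tendsto Φ atBot (𝓝 (-a)) := by
    simpa [Function.comp_def] using (hl.tendsto.comp tendsto_neg_atBot_atTop).sub_const a
  have hρb : Tendsto (fun x => 2 * ε * (V x * Φ x) - c * p x) atBot (𝓝 0) := by
    simpa [Function.comp_def] using hρl.tendsto.comp tendsto_neg_atBot_atTop
  have hi1 : MeasureTheory.Integrable fun x => V x * (Φ x * Φ' x) := by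
    refine hVi.mul_bdd (c := (r + B) * (θ + Bp)) (hΦc.mul hΦ'c).aestronglyMeasurable
      (Eventually.of_forall fun x => ?_)
    rw [norm_mul]
    gcongr
    exacts [hΦB _, hΦ'B _]
  have hi2 : MeasureTheory.Integrable fun x => p x * Φ' x :=
    hpi.mul_bdd (c := θ + Bp) hΦ'c.aestronglyMeasurable (Eventually.of_forall hΦ'B)
  have hi3 : MeasureTheory.Integrable fun x => p x * p x :=
    hpi.mul_bdd (c := Bp) K.continuous'.aestronglyMeasurable (Eventually.of_forall hBp)
  have e : (fun x => (2 * ε * (V x * Φ x) - c * p x) * Φ' x) =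
      fun x => 2 * ε * (V x * (Φ x * Φ' x)) - c * (p x * Φ' x) := by funext x; ring
  -- With the Melnikov integral zero by hypothesis, the energy identity leaves `c ∫ p Φ' = 0`; the
  -- integral is positive because `Φ'` is within `θ` of `p`.
  have h3 := N.integral_forcing_eq_zero hΦ hΦ' lt lb hρr.tendsto hρb
    (by rw [e]; exact (hi1.const_mul _).sub (hi2.const_mul _))
  rw [e, MeasureTheory.integral_sub (hi1.const_mul _) (hi2.const_mul _),
    MeasureTheory.integral_const_mul, MeasureTheory.integral_const_mul, h0, mul_zero, zero_sub,
    neg_eq_zero] at h3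
  have hpos : 0 < ∫ x, p x * Φ' x := by
    have h4 : ∫ x, (p x * p x - p x * θ) ≤ ∫ x, p x * Φ' x :=
      MeasureTheory.integral_mono (hi3.sub (hpi.mul_const θ)) hi2 fun x => by
        have := (abs_le.1 (hnear' x)).1
        have h5 := hp x
        simp only
        nlinarith
    rw [MeasureTheory.integral_sub hi3 (hpi.mul_const θ), MeasureTheory.integral_mul_const] at h4
    linarith
  exact (mul_eq_zero.1 h3).resolve_right hpos.ne'

end IsHeteroclinic

/-! ### Assembly: existence, continuity and uniqueness of the kink modes -/

theorem mainTheorem1 (f V : ℝ → ℝ) (q₀ : ℝ) (φ₀ M' : ℝ → ℝ) (s₀ : ℝ)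
    (hf : ContDiffOn ℝ 1 f (Set.Ici 0))
    (hq₀ : 0 < q₀) (hf' : 0 < deriv f q₀)
    (hφ₀ : IsNLSKink f q₀ φ₀)
    (hV : ContDiff ℝ 2 V)
    (hVdecay : ∃ C > 0, ∃ κ > 0, ∀ x : ℝ, |V x| ≤ C * Real.exp (-κ * |x|))
    (hM' : IsEffectiveForce V q₀ φ₀ M')
    (hroot : M' s₀ = 0) (hsimple : deriv M' s₀ ≠ 0) :
    ∃ ε₀ > 0, ∃ δ > 0, ∃ C > 0, ∃ (φ : ℝ → ℝ → ℝ) (s : ℝ → ℝ),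
      -- existence of a continuous branch of kink modes, `ε`-close to the kink
      (∀ ε : ℝ, |ε| < ε₀ →
        IsKinkMode f V q₀ ε (fun x => φ ε (x - s ε)) ∧
        (∀ x, |φ ε x - φ₀ x| ≤ C * |ε|) ∧ |s ε - s₀| ≤ C * |ε| ∧
        OrthogonalToTranslation φ₀ (φ ε) ∧
        TendstoUniformly φ (φ ε) (𝓝 ε) ∧ ContinuousAt s ε) ∧
      -- uniqueness, first of the kink mode, then of its profile and position
      (∀ ε : ℝ, 0 < |ε| → |ε| < ε₀ → ∀ (ψ : ℝ → ℝ) (σ : ℝ),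
        IsKinkMode f V q₀ ε (fun x => ψ (x - σ)) →
        (∀ x, |ψ x - φ₀ x| ≤ δ) → |σ - s₀| ≤ δ →
        (∀ x, ψ (x - σ) = φ ε (x - s ε)) ∧
        (OrthogonalToTranslation φ₀ ψ → ψ = φ ε ∧ σ = s ε)) := by
  set g := stationaryNonlinearity f q₀ with hg
  set a := √q₀ with ha
  have N : OddBistable g a := oddBistable_stationaryNonlinearity hf hq₀ hf'
  have hgc := N.contDiff.continuous
  have hVc := hV.continuous
  obtain ⟨p₀, hp₀, hp₀', hr₀, hl₀⟩ := (isKinkMode_iff (V := 0) hgc continuous_const).1 hφ₀.kinkMode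
  have K₀ : IsHeteroclinic g a φ₀ p₀ := ⟨hp₀, fun x => by simpa using hp₀' x, hr₀, hl₀⟩
  have hder : deriv φ₀ = p₀ := funext fun x => (hp₀ x).deriv
  have K := K₀.comp_sub_const s₀
  obtain ⟨CV, hCV, κ, hκ, hVe⟩ := hVdecay
  have hVB : ∀ x, |V x| ≤ CV := fun x => (hVe x).trans
    (mul_le_of_le_one_right hCV.le (Real.exp_le_one_iff.2 (by nlinarith [abs_nonneg x])))
  have hVr : RightDecay V := ⟨CV, κ, hκ, fun x => (hVe x).trans (by
    have : -κ * |x| ≤ -κ * x := by nlinarith [le_abs_self x]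
    gcongr)⟩
  have hVl : RightDecay fun x => V (-x) := ⟨CV, κ, hκ, fun x => (hVe (-x)).trans (by
    have : -κ * |-x| ≤ -κ * x := by rw [abs_neg]; nlinarith [le_abs_self x]
    gcongr)⟩
  have hVi : MeasureTheory.Integrable V := RightDecay.integrable hVc hVr hVl
  have hVt := hVr.tendsto
  have hVb : Tendsto V atBot (𝓝 0) := by
    simpa [Function.comp_def] using hVl.tendsto.comp tendsto_neg_atBot_atTop
  have hV1 : ContDiff ℝ 1 V := hV.of_le one_le_two
  have h0 : ∫ x, V x * (φ₀ (x - s₀) * p₀ (x - s₀)) = 0 := by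
    have := K₀.effectiveForce_eq N hV1 hVi hVt hVb hM' s₀
    rw [hroot] at this
    linarith
  -- This integral equals `-M''(s₀)/2`.
  have h1 : ∫ x, V x * (p₀ (x - s₀) * p₀ (x - s₀) + φ₀ (x - s₀) * g (φ₀ (x - s₀))) ≠ 0 := by
    intro h
    rw [(K₀.hasDerivAt_effectiveForce N hV1 hVi hVt hVb hM' s₀).deriv,
      MeasureTheory.integral_neg, h] at hsimple
    simp at hsimple
  obtain ⟨ε₁, hε₁, ρ, hρ, L, hL, w, w', hw, hwL, hwu⟩ := K.exists_branch N hVc hVi hVB h0 h1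
  obtain ⟨r, hr, hdecay⟩ := K.exists_rightDecay_of_near N
  obtain ⟨η, hη, c, hc, hslope⟩ := K₀.exists_displacement_slope N s₀
  obtain ⟨Lp, hLp, hlip⟩ := K₀.abs_sub_le N
  obtain ⟨Bp, hBp0, hBp⟩ := K₀.exists_deriv_bound N
  obtain ⟨Bk, hBk⟩ := K₀.exists_bound
  have hp₀pos := K₀.deriv_pos N
  set I := ∫ x, p₀ x with hI
  have hI' : ∫ x, p₀ (x - s₀) = I := MeasureTheory.integral_sub_right_eq_self p₀ s₀
  have hI0 : 0 ≤ I := MeasureTheory.integral_nonneg fun x => (hp₀pos x).le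
  set P := ∫ x, p₀ (x - s₀) * p₀ (x - s₀) with hP
  have hP0 : 0 < P := MeasureTheory.integral_pos_of_integrable_nonneg_nonzero (x := 0)
    (K.continuous'.mul K.continuous')
    ((K.integrable_deriv N).mul_bdd (c := Bp) K.continuous'.aestronglyMeasurable
      (Eventually.of_forall fun x => hBp _))
    (fun x => (mul_pos (hp₀pos _) (hp₀pos _)).le) (mul_pos (hp₀pos _) (hp₀pos _)).ne'
  -- The admissible `C¹` distance to the kink: `r` for exponential decay, `η` for the displacement
  -- slope, `P/(I+1)` for the vanishing of the multiplier, and `c/(I+1)` to keep the position within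
  -- `1` of `s₀`.
  set τ := min (min r η) (min (P / (I + 1)) (c / (I + 1))) with hτ
  have hτ0 : 0 < τ := by positivity
  have hτr : τ ≤ r := (min_le_left _ _).trans (min_le_left _ _)
  have hτη : τ ≤ η := (min_le_left _ _).trans (min_le_right _ _)
  have hτP : I * τ < P := by
    have : τ ≤ P / (I + 1) := (min_le_right _ _).trans (min_le_left _ _)
    rw [le_div_iff₀ (by positivity)] at this
    linarith
  have hτc : I / c * τ ≤ 1 := by
    have : τ ≤ c / (I + 1) := (min_le_right _ _).trans (min_le_right _ _)
    rw [le_div_iff₀ (by positivity)] at this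
    rw [div_mul_eq_mul_div, div_le_one hc]
    linarith
  set ε₀ := min ε₁ (τ / L) with hε₀def
  have hε₀ : 0 < ε₀ := by positivity
  have hsmall : ∀ ε : ℝ, |ε| < ε₀ → |ε| < ε₁ ∧ L * |ε| ≤ τ := fun ε hε => by
    rw [hε₀def, lt_min_iff, lt_div_iff₀ hL] at hε
    exact ⟨hε.1, by linarith⟩
  let Φ : ℝ → ℝ → ℝ := fun ε x => φ₀ (x - s₀) + w ε x
  let Φ' : ℝ → ℝ → ℝ := fun ε x => p₀ (x - s₀) + w' ε x
  have hΦd : ∀ ε, |ε| < ε₀ → ∀ x, HasDerivAt (Φ ε) (Φ' ε x) x := fun ε hε x =>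
    (K.hasDerivAt x).add ((hw ε (hsmall ε hε).1).1 x)
  have hΦc : ∀ ε, Continuous (Φ ε) := fun ε => K.continuous.add (w ε).continuous
  have hΦn : ∀ ε, |ε| < ε₀ → ∀ x, |Φ ε x - φ₀ (x - s₀)| ≤ L * |ε| := fun ε hε x => by
    rw [add_sub_cancel_left]
    exact ((w ε).norm_coe_le_norm x).trans (hw ε (hsmall ε hε).1).2.2.2.1
  have hΦn' : ∀ ε, |ε| < ε₀ → ∀ x, |Φ' ε x - p₀ (x - s₀)| ≤ L * |ε| := fun ε hε x => by
    rw [add_sub_cancel_left]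
    exact ((w' ε).norm_coe_le_norm x).trans (hw ε (hsmall ε hε).1).2.2.2.2
  have hΦB : ∀ ε, |ε| < ε₀ → ∀ x, |Φ ε x| ≤ Bk + τ := fun ε hε x => by
    have := abs_add_le (Φ ε x - φ₀ (x - s₀)) (φ₀ (x - s₀))
    rw [sub_add_cancel] at this
    linarith [hΦn ε hε x, (hsmall ε hε).2, hBk (x - s₀)]
  have hΦΦ : ∀ ε ε', |ε| < ε₀ → |ε'| < ε₀ → ∀ x, |Φ ε x - Φ ε' x| ≤ L * |ε - ε'| :=
    fun ε ε' hε hε' x => by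
      rw [add_sub_add_left_eq_sub]
      exact ((w ε - w ε').norm_coe_le_norm x).trans (hwL ε ε' (hsmall ε hε).1 (hsmall ε' hε').1)
  have hkink : ∀ ε, |ε| < ε₀ → IsKinkMode f V q₀ ε (Φ ε) := fun ε hε => by
    obtain ⟨hwd, ⟨b, hwd'⟩, hint, -, -⟩ := hw ε (hsmall ε hε).1
    have hd' : ∀ x, HasDerivAt (Φ' ε) (g (Φ ε x) + (2 * ε * (V x * Φ ε x) - b * p₀ (x - s₀))) x :=
      fun x => by
        convert! (K.hasDerivAt' x).add (hwd' x) using 1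
        ring
    obtain ⟨hb0, hrd, hld⟩ := K.multiplier_eq_zero N hVi hVr hVl hVB (hΦd ε hε) hd' hint
      (fun x => (hΦn ε hε x).trans ((hsmall ε hε).2.trans hτr))
      (fun x => (hΦn' ε hε x).trans (hsmall ε hε).2) (by rw [hI']; exact hτP) hdecay
    refine (isKinkMode_iff hgc hVc).2 ⟨Φ' ε, hΦd ε hε, fun x => ?_, hrd, hld⟩
    simpa [hb0] using hd' x
  have hsl : ∀ ε, |ε| < ε₀ → ∀ s₁ s₂, s₁ ≤ s₂ → |s₁ - s₀| ≤ 1 → |s₂ - s₀| ≤ 1 →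
      c * (s₂ - s₁) ≤ displacement φ₀ p₀ (Φ ε) s₂ - displacement φ₀ p₀ (Φ ε) s₁ := fun ε hε =>
    hslope (Φ ε) (Φ' ε) (hΦd ε hε) ⟨_, hΦB ε hε⟩ fun x =>
      (hΦn' ε hε x).trans ((hsmall ε hε).2.trans hτη)
  have hsl' : ∀ ε, |ε| < ε₀ → ∀ s₁ s₂, |s₁ - s₀| ≤ 1 → |s₂ - s₀| ≤ 1 →
      c * |s₂ - s₁| ≤ |displacement φ₀ p₀ (Φ ε) s₂ - displacement φ₀ p₀ (Φ ε) s₁| :=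
    fun ε hε s₁ s₂ h₁ h₂ => by
      rcases le_total s₁ s₂ with h | h
      · rw [abs_of_nonneg (sub_nonneg.2 h)]
        exact (hsl ε hε s₁ s₂ h h₁ h₂).trans (le_abs_self _)
      · rw [abs_sub_comm, abs_of_nonneg (sub_nonneg.2 h), abs_sub_comm (displacement _ _ _ _)]
        exact (hsl ε hε s₂ s₁ h h₂ h₁).trans (le_abs_self _)
  have hpos : ∀ ε, ∃ s, |ε| < ε₀ →
      |s - s₀| ≤ I / c * (L * |ε|) ∧ displacement φ₀ p₀ (Φ ε) s = 0 := fun ε => by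
    by_cases hε : |ε| < ε₀
    · obtain ⟨s, hs⟩ := K₀.exists_displacement_eq_zero N hc (hΦc ε) (hΦB ε hε) (hΦn ε hε)
        (le_trans (by gcongr; exact (hsmall ε hε).2) hτc) (hsl ε hε)
      exact ⟨s, fun _ => hs⟩
    · exact ⟨0, fun h => absurd h hε⟩
  choose s hs using hpos
  have hs1 : ∀ ε, |ε| < ε₀ → |s ε - s₀| ≤ 1 := fun ε hε =>
    (hs ε hε).1.trans (le_trans (by gcongr; exact (hsmall ε hε).2) hτc)
  -- The slope bound at `ε` controls `c|s ε - s ε'|` by the displacement of `Φ ε` at `s ε'`. The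
  -- displacement of `Φ ε'` vanishes there, and the two differ by at most `I L |ε - ε'|`.
  have hsL : ∀ ε ε', |ε| < ε₀ → |ε'| < ε₀ → |s ε - s ε'| ≤ I / c * (L * |ε - ε'|) :=
    fun ε ε' hε hε' => by
      have h2 := hsl' ε hε (s ε') (s ε) (hs1 ε' hε') (hs1 ε hε)
      have h3 := K₀.abs_displacement_sub_le N (hΦc ε) (hΦc ε') (hΦB ε hε) (hΦB ε' hε')
        (hΦΦ ε ε' hε hε') (s ε')
      rw [(hs ε' hε').2, sub_zero] at h3
      rw [(hs ε hε).2, zero_sub, abs_neg] at h2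
      rw [div_mul_eq_mul_div, le_div_iff₀ hc]
      linarith
  have hcont : ∀ ε, |ε| < ε₀ → ∀ᶠ ε' in 𝓝 ε, |ε'| < ε₀ := fun ε hε =>
    continuous_abs.continuousAt.eventually (gt_mem_nhds hε)
  have hlim : ∀ ε D : ℝ, Tendsto (fun ε' => D * |ε' - ε|) (𝓝 ε) (𝓝 0) := fun ε D => by
    have : Continuous fun ε' : ℝ => D * |ε' - ε| := by fun_prop
    simpa using this.tendsto ε
  -- In `δ`, the bound `1` keeps `σ` in the slope window; the other bound makes `ψ(x - σ)` differ
  -- from `φ₀(x - s₀)` by at most `δ + Lp δ ≤ ρ/2`. In `C`, `L` accounts for the profile, `Lp (I/c)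
  -- L` for its shift, and `(I/c) L` for the position.
  refine ⟨ε₀, hε₀, min 1 (ρ / (2 * (1 + Lp))), by positivity, L + (Lp + 1) * (I / c * L),
    by positivity, fun ε x => Φ ε (x + s ε), s, fun ε hε => ⟨?_, fun x => ?_, ?_, ?_, ?_, ?_⟩,
    fun ε hε0 hε ψ σ hψ hψn hσ => ?_⟩
  · simpa using hkink ε hε
  · have h2 := hΦn ε hε (x + s ε)
    have h3 := hlip (x + s ε - s₀) x
    have h4 := (hs ε hε).1
    rw [show x + s ε - s₀ - x = s ε - s₀ by ring] at h3
    have h5 := abs_sub_le (Φ ε (x + s ε)) (φ₀ (x + s ε - s₀)) (φ₀ x)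
    have h6 := mul_le_mul_of_nonneg_left h4 hLp.le
    have h7 : 0 ≤ I / c * L * |ε| := by positivity
    calc _ ≤ L * |ε| + Lp * (I / c * (L * |ε|)) := by linarith
      _ ≤ _ := by linarith
  · have h4 := (hs ε hε).1
    have h6 : 0 ≤ L * |ε| + Lp * (I / c * L) * |ε| := by positivity
    linarith
  · rw [OrthogonalToTranslation, hder]
    exact (hs ε hε).2
  · rw [Metric.tendstoUniformly_iff]
    intro e he
    filter_upwards [hcont ε hε,
      (hlim ε ((Bp + τ) * (I / c * L) + L)).eventually (gt_mem_nhds he)] with ε' hε' hlt x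
    rw [Real.dist_eq]
    refine lt_of_le_of_lt ?_ hlt
    have h2 := convex_univ.norm_image_sub_le_of_norm_hasDerivWithin_le (C := Bp + τ)
      (fun z _ => (hΦd ε hε z).hasDerivWithinAt) (fun z _ => by
        have h3 := abs_add_le (Φ' ε z - p₀ (z - s₀)) (p₀ (z - s₀))
        rw [sub_add_cancel] at h3
        rw [Real.norm_eq_abs]
        linarith [hΦn' ε hε z, (hsmall ε hε).2, hBp (z - s₀)])
      (Set.mem_univ (x + s ε')) (Set.mem_univ (x + s ε))
    rw [add_sub_add_left_eq_sub, Real.norm_eq_abs, Real.norm_eq_abs] at h2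
    have h3 := hΦΦ ε ε' hε hε' (x + s ε')
    have h4 := mul_le_mul_of_nonneg_left (hsL ε ε' hε hε') (by positivity : 0 ≤ Bp + τ)
    have h5 := abs_sub_le (Φ ε (x + s ε)) (Φ ε (x + s ε')) (Φ ε' (x + s ε'))
    rw [abs_sub_comm ε ε'] at h3 h4
    linarith
  · rw [ContinuousAt, tendsto_iff_dist_tendsto_zero]
    refine squeeze_zero' (Eventually.of_forall fun _ => dist_nonneg) ?_ (hlim ε (I / c * L))
    filter_upwards [hcont ε hε] with ε' hε'
    rw [Real.dist_eq, mul_assoc]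
    exact hsL ε' ε hε' hε
  · have hδ1 : |σ - s₀| ≤ 1 := hσ.trans (min_le_left _ _)
    have hδρ : min 1 (ρ / (2 * (1 + Lp))) * (1 + Lp) ≤ ρ / 2 := by
      have := min_le_right 1 (ρ / (2 * (1 + Lp)))
      calc _ ≤ ρ / (2 * (1 + Lp)) * (1 + Lp) := by gcongr
        _ = ρ / 2 := by field_simp
    set δ := min 1 (ρ / (2 * (1 + Lp)))
    obtain ⟨Ψ', hΨ, hΨ', hΨr, hΨl⟩ := (isKinkMode_iff hgc hVc).1 hψ
    obtain ⟨⟨B', hB'⟩, hint⟩ := IsHeteroclinic.integral_potential_eq_zero N hVi hVt hVb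
      (abs_pos.1 hε0) hΨ hΨ' hΨr hΨl
    have hΨc : Continuous fun x => ψ (x - σ) :=
      continuous_iff_continuousAt.2 fun x => (hΨ x).continuousAt
    have hΨ'c : Continuous Ψ' := continuous_iff_continuousAt.2 fun x => (hΨ' x).continuousAt
    have hnear : ∀ x, |ψ (x - σ) - φ₀ (x - s₀)| ≤ ρ / 2 := fun x => by
      have h2 := hψn (x - σ)
      have h3 := hlip (x - σ) (x - s₀)
      rw [sub_sub_sub_cancel_left, abs_sub_comm s₀ σ] at h3
      have h4 := mul_le_mul_of_nonneg_left hσ hLp.le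
      linarith [abs_sub_le (ψ (x - σ)) (φ₀ (x - σ)) (φ₀ (x - s₀))]
    let u : ℝ →ᵇ ℝ := .ofNormedAddCommGroup (fun x => ψ (x - σ) - φ₀ (x - s₀))
      (hΨc.sub K.continuous) (ρ / 2) hnear
    let u' : ℝ →ᵇ ℝ := .ofNormedAddCommGroup (fun x => Ψ' x - p₀ (x - s₀))
      (hΨ'c.sub K.continuous') (B' + Bp) fun x => (norm_sub_le _ _).trans
        (add_le_add (hB' x) (hBp _))
    have eu : ∀ x, φ₀ (x - s₀) + u x = ψ (x - σ) := fun x => add_sub_cancel _ _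
    have eu' : ∀ x, p₀ (x - s₀) + u' x = Ψ' x := fun x => add_sub_cancel _ _
    have huw : u = w ε := hwu ε u u' (hsmall ε hε).1
      (lt_of_le_of_lt ((BoundedContinuousFunction.norm_le (by positivity)).2 hnear) (by linarith))
      (fun x => (hΨ x).sub (K.hasDerivAt x)) (fun x => by
        rw [eu]
        convert! (hΨ' x).sub (K.hasDerivAt' x) using 1
        ring) (by
        simp only [eu, eu']
        exact hint)
    have hΨΦ : ∀ x, ψ (x - σ) = Φ ε x := fun x => by rw [← eu, huw]
    refine ⟨fun x => by simp only [hΨΦ, sub_add_cancel], fun horth => ?_⟩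
    have hψ' : ∀ x, ψ x = Φ ε (x + σ) := fun x => by rw [← hΨΦ, add_sub_cancel_right]
    have hJ : displacement φ₀ p₀ (Φ ε) σ = 0 := by
      rw [OrthogonalToTranslation, hder] at horth
      simpa only [displacement, ← hψ'] using horth
    -- Both positions are zeros of one displacement function in the window where its slope is at
    -- least `c`.
    have hσs : σ = s ε := by
      have h2 := hsl' ε hε (s ε) σ (hs1 ε hε) hδ1
      rw [hJ, (hs ε hε).2, sub_zero, abs_zero] at h2
      have h3 : |σ - s ε| ≤ 0 := nonpos_of_mul_nonpos_right h2 hc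
      exact sub_eq_zero.1 (abs_nonpos_iff.1 h3)
    exact ⟨funext fun x => by rw [hψ', hσs], hσs⟩
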